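/- **Spin-1 one-point functions of the massless XXZ chain.** Let $0<\zeta<\pi/2$, $\eta=i\zeta$, $\xi\in\mathbb R$, $w_1=\xi$, $w_2=\xi-\eta$, and $\rho(\lambda)=\dfrac{1}{2\zeta\cosh(\pi\lambda/\zeta)}$. For $\varepsilon'=(\varepsilon'_1,\varepsilon'_2)$ and $\varepsilon=(\varepsilon_1,\varepsilon_2)$ in $\{0,1\}^2$ with $\varepsilon_1'+\varepsilon_2'=\varepsilon_1+\varepsilon_2$ put $\alpha^-=\{j:\varepsilon'_j=1\}$, $\alpha^+=\{j:\varepsilon_j=0\}$, $\alpha_+=|\alpha^+|$, and name the variables by $(\tilde\lambda'_{j'_{\max}},\dots,\tilde\lambda'_{j'_{\min}},\tilde\lambda_{j_{\min}},\dots,\tilde\lambda_{j_{\max}})=(\lambda_1,\lambda_2)$, where $j'$ runs through $\alpha^+$ and $j$ through $\alpha^-$. For $\epsilon>0$ let $$Q(\lambda_1,\lambda_2)=(-1)^{\alpha_+}\frac{\prod_{j\in\alpha^-}\Big(\prod_{k<j}\sinh(\tilde\lambda_j-w_k+\eta)\prod_{k>j}\sinh(\tilde\lambda_j-w_k)\Big)\prod_{j\in\alpha^+}\Big(\prod_{k<j}\sinh(\tilde\lambda'_j-w_k-\eta)\prod_{k>j}\sinh(\tilde\lambda'_j-w_k)\Big)}{\sinh(\lambda_2-\lambda_1+\eta+\epsilon_{21})\,\sinh(w_1-w_2)},$$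 where $k\in\{1,2\}$ and $\epsilon_{21}=\pm i\epsilon$ according to whether $\pm\,\mathrm{Im}(\lambda_2-\lambda_1)>0$ ($\epsilon_{21}=0$ if the imaginary part vanishes). Let each $\lambda_j$ run over the two lines $\mathbb R-(\gamma-1)\eta+i\sigma_j\epsilon$, $\gamma=1,2$, with $\sigma_j=+1$ for $j\le\alpha_+$ and $\sigma_j=-1$ for $j>\alpha_+$; write $\alpha(\lambda_j)=\gamma$ on the $\gamma$-th line and $S_{jk}=\rho(\lambda_j-w_k+\eta/2)\,\delta_{\alpha(\lambda_j),k}$. Define $$\langle e_1^{\varepsilon'_1,\varepsilon_1}e_2^{\varepsilon'_2,\varepsilon_2}\rangle=\lim_{\epsilon\to0+}\int d\lambda_1\int d\lambda_2\;Q(\lambda_1,\lambda_2)\det S(\lambda_1,\lambda_2),$$ each integral being the sum of the integrals over the two lines. For $i=0,1,2$ the one-point function $\langle E^{ii}\rangle$ is given by the limit, as $\epsilon\to0+$, of the sum of these double integrals over all $\varepsilon$ with $\varepsilon_1+\varepsilon_2=i$, for a fixed $\varepsilon'$ with $\varepsilon'_1+\varepsilon'_2=i$. Then, for all $\varepsilon',\varepsilon$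 as above, the double integrals over all pairs of lines converge absolutely for all sufficiently small $\epsilon>0$; the limits exist; $\langle E^{ii}\rangle$ does not depend on the choice of $\varepsilon'$; and $$\langle E^{11}\rangle=\frac{\cos\zeta\,(\sin\zeta-\zeta\cos\zeta)}{\zeta\sin^2\zeta}.$$ The same value is obtained from each single double integral with $\varepsilon_1+\varepsilon_2=\varepsilon'_1+\varepsilon'_2=1$, that is, $$\langle E^{11}\rangle=2\langle e_1^{1,1}e_2^{0,0}\rangle=2\langle e_1^{0,1}e_2^{1,0}\rangle=2\langle e_1^{0,0}e_2^{1,1}\rangle=2\langle e_1^{1,0}e_2^{0,1}\rangle .$$ Moreover $\langle E^{22}\rangle=\langle E^{00}\rangle=\dfrac{\zeta-\sin\zeta\cos\zeta}{2\zeta\sin^2\zeta}$, and therefore $$\langle E^{22}\rangle+\langle E^{11}\rangle+\langle E^{00}\rangle=1 .$$ -/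

import Mathlib

open Filter Topology MeasureTheory

noncomputable section

namespace SpinOneXXZ

/-- The parameter `η = i ζ` of the massless regime. -/
def eta (ζ : ℝ) : ℂ := Complex.I * ζ

/-- The density of string centres `ρ(z) = 1 / (2 ζ cosh (π z / ζ))`, on the complex plane. -/
def rho (ζ : ℝ) (z : ℂ) : ℂ := 1 / (2 * ζ * Complex.cosh (Real.pi * z / ζ))

/-- The complete 2-string of inhomogeneities `w₁ = ξ`, `w₂ = ξ - η`.  Here and below the sites,
the rapidities and the strings, numbered `1, 2` on paper, are numbered by `0, 1 : Fin 2`. -/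
def inhom (ζ ξ : ℝ) (k : Fin 2) : ℂ := ξ - (k : ℕ) * eta ζ

/-- The set `α⁻ = {j ; ε'_j = 1}`. -/
def alphaMinus (e' : Fin 2 → Fin 2) : Finset (Fin 2) := Finset.univ.filter fun j => e' j = 1

/-- The set `α⁺ = {j ; ε_j = 0}`. -/
def alphaPlus (e : Fin 2 → Fin 2) : Finset (Fin 2) := Finset.univ.filter fun j => e j = 0

/-- The number of entries equal to `1` in a sequence of zeros and ones. -/
def weight (e : Fin 2 → Fin 2) : ℕ := ∑ j, (e j : ℕ)

/-- `λ̃'_j` for `j ∈ α⁺`.  The rapidities `λ₁, λ₂` are assigned in order to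
`λ̃'_{j'max}, …, λ̃'_{j'min}, λ̃_{jmin}, …, λ̃_{jmax}` with `j' ∈ α⁺` and `j ∈ α⁻`. -/
def lamPlus (e : Fin 2 → Fin 2) (lam : Fin 2 → ℂ) (j : Fin 2) : ℂ :=
  lam (Fin.ofNat 2 ((alphaPlus e).filter fun k => j < k).card)

/-- `λ̃_j` for `j ∈ α⁻`, see `lamPlus`; the position is at most `1` (counted from `0`)
because `|α⁺| + |α⁻| = 2` whenever `e'` and `e` have the same weight. -/
def lamMinus (e' e : Fin 2 → Fin 2) (lam : Fin 2 → ℂ) (j : Fin 2) : ℂ :=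
  lam (Fin.ofNat 2 ((alphaPlus e).card + ((alphaMinus e').filter fun k => k < j).card))

/-- The regulator: `iε` if the imaginary part of the rapidity difference `z` is positive, `-iε` if
it is negative. -/
def regulator (ε : ℝ) (z : ℂ) : ℂ :=
  if 0 < z.im then Complex.I * ε else if z.im < 0 then -(Complex.I * ε) else 0

/-- The factor `Q({ε_j, ε'_j}; λ₁, λ₂)` of the multiple-integral representation. -/
def Q (ζ ξ ε : ℝ) (e' e : Fin 2 → Fin 2) (lam : Fin 2 → ℂ) : ℂ :=
  (-1) ^ (alphaPlus e).card *
  ((∏ j ∈ alphaMinus e',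
      ((∏ k ∈ Finset.Iio j, Complex.sinh (lamMinus e' e lam j - inhom ζ ξ k + eta ζ)) *
        ∏ k ∈ Finset.Ioi j, Complex.sinh (lamMinus e' e lam j - inhom ζ ξ k))) /
    ∏ k : Fin 2, ∏ l ∈ Finset.Ioi k,
      Complex.sinh (lam l - lam k + eta ζ + regulator ε (lam l - lam k))) *
  ((∏ j ∈ alphaPlus e,
      ((∏ k ∈ Finset.Iio j, Complex.sinh (lamPlus e lam j - inhom ζ ξ k - eta ζ)) *
        ∏ k ∈ Finset.Ioi j, Complex.sinh (lamPlus e lam j - inhom ζ ξ k))) /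
    ∏ k : Fin 2, ∏ l ∈ Finset.Ioi k, Complex.sinh (inhom ζ ξ k - inhom ζ ξ l))

/-- The matrix `S_{jk} = ρ(λ_j - w_k + η/2) δ(α(λ_j), k)`, where `α(λ_j) = γ j` records which of the
two contours the variable `λ_j` runs over. -/
def S (ζ ξ : ℝ) (γ : Fin 2 → Fin 2) (lam : Fin 2 → ℂ) : Matrix (Fin 2) (Fin 2) ℂ :=
  Matrix.of fun j k => if γ j = k then rho ζ (lam j - inhom ζ ξ k + eta ζ / 2) else 0

/-- The point with real part `x` on the contour for `λ_j` with string label `γ`: the horizontal line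
through `-γ η ± iε` (`γ = 0, 1`), with the upper sign for the first `|α⁺|` variables and the lower
sign for the others. -/
def contourPoint (ζ ε : ℝ) (e : Fin 2 → Fin 2) (j γ : Fin 2) (x : ℝ) : ℂ :=
  x - (γ : ℕ) * eta ζ + Complex.I * (if (j : ℕ) < (alphaPlus e).card then (ε : ℂ) else -(ε : ℂ))

/-- The integrand `Q det S` on the product of the contours with labels `γ 0` and `γ 1`. -/
def integrand (ζ ξ ε : ℝ) (e' e γ : Fin 2 → Fin 2) (x₁ x₂ : ℝ) : ℂ :=
  Q ζ ξ ε e' e ![contourPoint ζ ε e 0 (γ 0) x₁, contourPoint ζ ε e 1 (γ 1) x₂] *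
    (S ζ ξ γ ![contourPoint ζ ε e 0 (γ 0) x₁, contourPoint ζ ε e 1 (γ 1) x₂]).det

/-- The double integral representing `⟨e₁^{ε'₁, ε₁} e₂^{ε'₂, ε₂}⟩`, at a given value of `ε`. -/
def doubleIntegral (ζ ξ ε : ℝ) (e' e : Fin 2 → Fin 2) : ℂ :=
  ∑ γ : Fin 2 → Fin 2, ∫ x₁ : ℝ, ∫ x₂ : ℝ, integrand ζ ξ ε e' e γ x₁ x₂

/-- The value of `⟨e₁^{ε'₁, ε₁} e₂^{ε'₂, ε₂}⟩` given by its double-integral representation is `v`;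
`ε` being an infinitesimal positive number, it is the limit `ε → 0+`. -/
def IsTwoSiteValue (ζ ξ : ℝ) (e' e : Fin 2 → Fin 2) (v : ℂ) : Prop :=
  Tendsto (fun ε : ℝ => doubleIntegral ζ ξ ε e' e) (𝓝[>] 0) (𝓝 v)

/-- The value of the one-point function `⟨E^{ii}⟩`, `i = 0, 1, 2`, given by its representation as
the sum of double integrals over all sequences `e` with `i` ones, is `v`, whichever
sequence `e'` with `i` ones is used in it. The normalization factor `C` equals `1`. -/
def IsOnePointValue (ζ ξ : ℝ) (i : Fin 3) (v : ℂ) : Prop :=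
  ∀ e' : Fin 2 → Fin 2, weight e' = i →
    Tendsto (fun ε : ℝ => ∑ e : Fin 2 → Fin 2 with weight e = i, doubleIntegral ζ ξ ε e' e)
      (𝓝[>] 0) (𝓝 v)

end SpinOneXXZ

end

noncomputable section

namespace SpinOneXXZ

/-! ### Elementary estimates for hyperbolic functions -/

/-! The determinant of `S` vanishes unless the two variables run over different lines, so two string
labellings survive. With κ = π/ζ ≥ 2 and each variable measured from its string position, both
become integrals of sinh(z₀+iθ₀) sinh(z₁+iθ₁) / (sinh κz₀ · sinh κz₁ · sinh(z₁−z₀+ic)), see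
`pairIntegral`. The first has (θ₀, θ₁, c) = (θ, 0, −ε), the second (θ−ζ, ζ, 2ζ+ε), and
`doubleIntegral_eq` gives the double integral as a multiple of their difference. Here θ = ±ζ. Only
the sequence `e` affects θ and the sides of the contours; at weight one `e'` drops out because w₂ =
w₁ − η.

The integrand is bounded by a multiple of 1/(cosh x₀ · cosh x₁) (`norm_pair_le`), so contours may be
moved as long as residues are recorded. Moving them to fixed heights, away from all poles, lets the
regulator tend to its limit under the integral sign. At the limit, sinh κ(z+iζ) = −sinh κz turns the
second term into the first one on other contours (`pairIntegral_translate`), and the difference is a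
sum of residues (`pairIntegral_sub`). The pole z₀ = 0 gives 2iζ² sin θ. The pole z₁ = 0 gives
nothing, since sinh z₁ cancels it. The diagonal z₁ = z₀ gives a single integral on Im z = −ζ/2,
evaluated in `integral_kern_mul_kern`. By `string_difference_eq` the total is the same for θ = ζ and
θ = −ζ, so all weight-one integrals agree.

For weights 0 and 2 both contours lie on the same side of the real axis. Moving one of them across
it, to reach the weight-one configuration, changes the difference by 2iζ² sin ζ in either case, so
both limits are given by `amplitude_mul_sub`. The sum rule then reduces to sin² + cos² = 1. -/

lemma normSq_sinh (z : ℂ) : ‖Complex.sinh z‖ ^ 2 = Real.sinh z.re ^ 2 + Real.sin z.im ^ 2 := by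
  have h : Complex.sinh z = ((Real.sinh z.re * Real.cos z.im : ℝ) : ℂ)
      + ((Real.cosh z.re * Real.sin z.im : ℝ) : ℂ) * Complex.I := by
    conv_lhs => rw [← Complex.re_add_im z, Complex.sinh_add, Complex.sinh_mul_I,
      Complex.cosh_mul_I]
    push_cast
    ring
  rw [h, ← Complex.normSq_eq_norm_sq, Complex.normSq_add_mul_I]
  have h1 := Real.cosh_sq z.re
  have h2 := Real.sin_sq_add_cos_sq z.im
  linear_combination (Real.sin z.im ^ 2) * h1 + (Real.sinh z.re ^ 2) * h2

lemma norm_sinh_le (z : ℂ) : ‖Complex.sinh z‖ ≤ Real.cosh z.re := by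
  refine abs_le_of_sq_le_sq' ?_ (Real.cosh_pos _).le |>.2
  rw [normSq_sinh, Real.cosh_sq]
  have := Real.sin_sq_le_one z.im
  linarith

lemma abs_sinh_re_le_norm_sinh (z : ℂ) : |Real.sinh z.re| ≤ ‖Complex.sinh z‖ := by
  refine abs_le_of_sq_le_sq ?_ (norm_nonneg _)
  rw [normSq_sinh]
  nlinarith [sq_nonneg (Real.sin z.im)]

lemma abs_sin_mul_cosh_le_norm_sinh (z : ℂ) :
    |Real.sin z.im| * Real.cosh z.re ≤ ‖Complex.sinh z‖ := by
  refine abs_le_of_sq_le_sq' ?_ (norm_nonneg _) |>.2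
  rw [normSq_sinh, mul_pow, sq_abs, Real.cosh_sq]
  nlinarith [sq_nonneg (Real.sinh z.re), Real.sin_sq_le_one z.im]

lemma abs_sin_le_norm_sinh (z : ℂ) : |Real.sin z.im| ≤ ‖Complex.sinh z‖ := by
  refine le_trans ?_ (abs_sin_mul_cosh_le_norm_sinh z)
  exact le_mul_of_one_le_right (abs_nonneg _) (Real.one_le_cosh _)

lemma sinh_ne_zero_of_sin_im {z : ℂ} (h : Real.sin z.im ≠ 0) : Complex.sinh z ≠ 0 := by
  rw [← norm_pos_iff]
  exact (abs_pos.2 h).trans_le (abs_sin_le_norm_sinh z)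

lemma sinh_ne_zero_of_re {z : ℂ} (h : z.re ≠ 0) : Complex.sinh z ≠ 0 := by
  rw [← norm_pos_iff]
  exact (abs_pos.2 (Real.sinh_eq_zero.not.2 h)).trans_le (abs_sinh_re_le_norm_sinh z)

lemma one_add_sq_div_two_le_cosh (x : ℝ) : 1 + x ^ 2 / 2 ≤ Real.cosh x := by
  have h : Real.cosh x = 1 + 2 * Real.sinh (x / 2) ^ 2 := by
    have h1 := Real.cosh_two_mul (x / 2)
    rw [mul_div_cancel₀ x two_ne_zero, Real.cosh_sq] at h1
    linarith
  have h2 : |x / 2| ≤ |Real.sinh (x / 2)| := by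
    rcases le_total 0 (x / 2) with hx | hx
    · rw [abs_of_nonneg hx, abs_of_nonneg (Real.sinh_nonneg_iff.2 hx)]
      exact Real.self_le_sinh_iff.2 hx
    · rw [abs_of_nonpos hx, abs_of_nonpos (Real.sinh_nonpos_iff.2 hx)]
      exact neg_le_neg (Real.sinh_le_self_iff.2 hx)
  have h3 := sq_le_sq.2 h2
  rw [h]
  linarith

lemma inv_cosh_pos (x : ℝ) : 0 < (Real.cosh x)⁻¹ := inv_pos.2 (Real.cosh_pos x)

lemma integrable_inv_cosh : Integrable fun x : ℝ => (Real.cosh x)⁻¹ := by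
  refine (integrable_inv_one_add_sq.const_mul 2).mono'
    (Real.continuous_cosh.inv₀ fun x => (Real.cosh_pos x).ne').aestronglyMeasurable
    (.of_forall fun x => ?_)
  rw [Real.norm_of_nonneg (inv_cosh_pos x).le, ← div_eq_mul_inv, inv_eq_one_div,
    div_le_div_iff₀ (Real.cosh_pos x) (by positivity)]
  nlinarith [one_add_sq_div_two_le_cosh x]

lemma tendsto_inv_cosh_atTop : Tendsto (fun x : ℝ => (Real.cosh x)⁻¹) atTop (𝓝 0) := by
  refine tendsto_inv_atTop_zero.comp (tendsto_atTop_mono (f := fun x : ℝ => x) (fun x => ?_) tendsto_id)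
  nlinarith [one_add_sq_div_two_le_cosh x, sq_nonneg (x - 1)]

/-- The addition formula for cosh((κ−1)x + x) leaves the extra term sinh((κ−1)x) sinh x, which is
nonnegative for κ ≥ 1. -/
lemma cosh_mul_cosh_le {κ : ℝ} (hκ : 1 ≤ κ) (x : ℝ) :
    Real.cosh ((κ - 1) * x) * Real.cosh x ≤ Real.cosh (κ * x) := by
  have h : κ * x = (κ - 1) * x + x := by ring
  rw [h, Real.cosh_add]
  have : 0 ≤ Real.sinh ((κ - 1) * x) * Real.sinh x := by
    rcases le_total 0 x with hx | hx
    · exact mul_nonneg (Real.sinh_nonneg_iff.2 (mul_nonneg (by linarith) hx))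
        (Real.sinh_nonneg_iff.2 hx)
    · exact mul_nonneg_of_nonpos_of_nonpos
        (Real.sinh_nonpos_iff.2 (mul_nonpos_of_nonneg_of_nonpos (by linarith) hx))
        (Real.sinh_nonpos_iff.2 hx)
  linarith

lemma cosh_le_cosh_mul {κ : ℝ} (hκ : 1 ≤ κ) (x : ℝ) : Real.cosh x ≤ Real.cosh (κ * x) :=
  (le_mul_of_one_le_left (Real.cosh_pos _).le (Real.one_le_cosh _)).trans (cosh_mul_cosh_le hκ x)

lemma cosh_sq_le_cosh_mul {κ : ℝ} (hκ : 2 ≤ κ) (x : ℝ) :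
    Real.cosh x * Real.cosh x ≤ Real.cosh (κ * x) := by
  refine le_trans ?_ (cosh_mul_cosh_le (by linarith) x)
  exact mul_le_mul_of_nonneg_right (cosh_le_cosh_mul (by linarith) x) (Real.cosh_pos _).le

/-- Away from the imaginary axis `|sinh (κ x)|` is comparable with `cosh (κ x)`. -/
lemma tanh_mul_cosh_le {κ x : ℝ} (hκ : 0 < κ) (hx : 1 ≤ |x|) :
    Real.tanh κ * Real.cosh (κ * x) ≤ |Real.sinh (κ * x)| := by
  have key : ∀ t, κ ≤ t → Real.tanh κ * Real.cosh t ≤ Real.sinh t := by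
    intro t ht
    rw [Real.tanh_eq_sinh_div_cosh, div_mul_eq_mul_div, div_le_iff₀ (Real.cosh_pos _)]
    have := Real.sinh_nonneg_iff.2 (sub_nonneg.2 ht)
    rw [Real.sinh_sub] at this
    linarith
  have h := key (κ * |x|) (le_mul_of_one_le_right hκ.le hx)
  rwa [← Real.cosh_abs (κ * x), Real.abs_sinh, abs_mul, abs_of_pos hκ]

lemma integral_inv_cosh : ∫ x : ℝ, (Real.cosh x)⁻¹ = Real.pi := by
  have hd : ∀ x : ℝ, HasDerivAt (fun x => 2 * Real.arctan (Real.exp x)) (Real.cosh x)⁻¹ x := by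
    intro x
    refine (((Real.hasDerivAt_exp x).arctan).const_mul 2).congr_deriv ?_
    rw [Real.cosh_eq, Real.exp_neg]
    have := Real.exp_pos x
    field_simp
    ring
  have ht : Tendsto (fun x => 2 * Real.arctan (Real.exp x)) atTop (𝓝 (2 * (Real.pi / 2))) :=
    (tendsto_nhds_of_tendsto_nhdsWithin (Real.tendsto_arctan_atTop.comp Real.tendsto_exp_atTop)).const_mul 2
  have hb : Tendsto (fun x => 2 * Real.arctan (Real.exp x)) atBot (𝓝 (2 * Real.arctan 0)) :=
    ((Real.continuous_arctan.tendsto 0).comp Real.tendsto_exp_atBot).const_mul 2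
  rw [integral_of_hasDerivAt_of_tendsto hd integrable_inv_cosh hb ht, Real.arctan_zero]
  ring

lemma integrable_inv_cosh_sq : Integrable fun x : ℝ => (Real.cosh x ^ 2)⁻¹ := by
  refine integrable_inv_cosh.mono'
    ((Real.continuous_cosh.pow 2).inv₀ fun x =>
      (pow_pos (Real.cosh_pos x) 2).ne').aestronglyMeasurable (.of_forall fun x => ?_)
  rw [Real.norm_of_nonneg (by positivity)]
  exact inv_anti₀ (Real.cosh_pos x) (le_self_pow₀ (Real.one_le_cosh x) two_ne_zero)

lemma integral_inv_cosh_sq : ∫ x : ℝ, (Real.cosh x ^ 2)⁻¹ = 2 := by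
  -- The antiderivative is tanh x − 1, written so that its limits at ±∞ are immediate.
  have hd : ∀ x : ℝ, HasDerivAt (fun x => -2 * (Real.exp (2 * x) + 1)⁻¹) (Real.cosh x ^ 2)⁻¹ x := by
    intro x
    have h2 : HasDerivAt (fun x : ℝ => Real.exp (2 * x) + 1) (Real.exp (2 * x) * (2 * 1)) x :=
      (((hasDerivAt_id x).const_mul 2).exp).add_const 1
    refine ((h2.inv (by positivity)).const_mul (-2)).congr_deriv ?_
    rw [Real.cosh_eq, Real.exp_neg, two_mul x, Real.exp_add]
    have := Real.exp_pos x
    field_simp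
  have ht : Tendsto (fun x : ℝ => -2 * (Real.exp (2 * x) + 1)⁻¹) atTop (𝓝 (-2 * 0)) := by
    refine Tendsto.const_mul _ (tendsto_inv_atTop_zero.comp (tendsto_atTop_add_const_right _ _ ?_))
    exact Real.tendsto_exp_atTop.comp (tendsto_id.const_mul_atTop two_pos)
  have hb : Tendsto (fun x : ℝ => -2 * (Real.exp (2 * x) + 1)⁻¹) atBot (𝓝 (-2 * (0 + 1)⁻¹)) := by
    refine Tendsto.const_mul _ (Tendsto.inv₀ (Tendsto.add_const _ ?_) (by norm_num))
    exact Real.tendsto_exp_atBot.comp (tendsto_id.const_mul_atBot two_pos)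
  rw [integral_of_hasDerivAt_of_tendsto hd integrable_inv_cosh_sq hb ht]
  norm_num

/-! ### Moving horizontal contours -/

/-- A continuous function that decays like `1 / cosh` is integrable. -/
lemma integrable_of_le_inv_cosh {f : ℝ → ℂ} {C : ℝ} (hf : Continuous f)
    (hC : ∀ x, 1 ≤ |x| → ‖f x‖ ≤ C * (Real.cosh x)⁻¹) : Integrable f := by
  obtain ⟨M, hM⟩ := (isCompact_Icc (a := (-1 : ℝ)) (b := 1)).exists_bound_of_continuousOn
    hf.continuousOn
  refine (integrable_inv_cosh.const_mul (|C| + |M| * Real.cosh 1)).mono' hf.aestronglyMeasurable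
    (.of_forall fun x => ?_)
  have hp := inv_cosh_pos x
  rcases le_total 1 |x| with hx | hx
  · refine (hC x hx).trans (mul_le_mul_of_nonneg_right ?_ hp.le)
    have := mul_nonneg (abs_nonneg M) (Real.cosh_pos 1).le
    linarith [le_abs_self C]
  · have h1 : Real.cosh x ≤ Real.cosh 1 := Real.cosh_le_cosh.2 (by simpa using hx)
    have h2 : 1 ≤ Real.cosh 1 * (Real.cosh x)⁻¹ := by
      rw [← div_eq_mul_inv]
      exact (one_le_div (Real.cosh_pos x)).2 h1
    calc ‖f x‖ ≤ |M| := (hM x (abs_le.1 hx)).trans (le_abs_self M)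
      _ ≤ |M| * (Real.cosh 1 * (Real.cosh x)⁻¹) := le_mul_of_one_le_right (abs_nonneg _) h2
      _ ≤ (|C| + |M| * Real.cosh 1) * (Real.cosh x)⁻¹ := by
        nlinarith [mul_nonneg (abs_nonneg C) hp.le]

lemma tendsto_vertical_integral {F : ℂ → ℂ} {a b C : ℝ} (hab : a ≤ b) {φ : ℝ → ℝ}
    (hφ : ∀ᶠ T in atTop, 1 ≤ |φ T|) (hφ' : ∀ T, |φ T| = |T|)
    (hC : ∀ z : ℂ, a ≤ z.im → z.im ≤ b → 1 ≤ |z.re| → ‖F z‖ ≤ C * (Real.cosh z.re)⁻¹) :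
    Tendsto (fun T => Complex.I • ∫ y in a..b, F (φ T + y * Complex.I)) atTop (𝓝 0) := by
  have h0 : Tendsto (fun T : ℝ => C * (Real.cosh T)⁻¹ * |b - a|) atTop (𝓝 0) := by
    simpa using (tendsto_inv_cosh_atTop.const_mul C).mul_const |b - a|
  refine squeeze_zero_norm' ?_ h0
  filter_upwards [hφ] with T hT
  rw [norm_smul, Complex.norm_I, one_mul]
  refine intervalIntegral.norm_integral_le_of_norm_le_const fun y hy => ?_
  rw [Set.uIoc_of_le hab] at hy
  have := hC (φ T + y * Complex.I) (by simpa using hy.1.le) (by simpa using hy.2) (by simpa using hT)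
  rwa [show ((φ T : ℂ) + y * Complex.I).re = φ T by simp, ← Real.cosh_abs, hφ',
    Real.cosh_abs] at this

/-- Cauchy's theorem on rectangles of width 2T with T → ∞; the vertical sides vanish by the decay.
At the origin continuity suffices, which admits quotients with a removed singularity there. -/
lemma integral_line_eq_of_continuous {F : ℂ → ℂ} {a b C : ℝ} (hab : a ≤ b)
    (hc : ∀ z : ℂ, a ≤ z.im → z.im ≤ b → ContinuousAt F z)
    (hd : ∀ z : ℂ, a ≤ z.im → z.im ≤ b → z ≠ 0 → DifferentiableAt ℂ F z)
    (hC : ∀ z : ℂ, a ≤ z.im → z.im ≤ b → 1 ≤ |z.re| → ‖F z‖ ≤ C * (Real.cosh z.re)⁻¹) :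
    ∫ x : ℝ, F (x + a * Complex.I) = ∫ x : ℝ, F (x + b * Complex.I) := by
  have hint : ∀ y : ℝ, a ≤ y → y ≤ b → Integrable fun x : ℝ => F (x + y * Complex.I) := by
    intro y h1 h2
    refine integrable_of_le_inv_cosh (C := C) ?_ ?_
    · rw [continuous_iff_continuousAt]
      intro x
      exact ContinuousAt.comp (g := F) (f := fun x : ℝ => (x : ℂ) + y * Complex.I)
        (hc _ (by simpa using h1) (by simpa using h2)) (by fun_prop)
    · intro x hx
      simpa using hC (x + y * Complex.I) (by simpa using h1) (by simpa using h2) (by simpa using hx)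
  have hrect : ∀ T : ℝ, ((∫ x in (-T)..T, F (x + a * Complex.I))
      - ∫ x in (-T)..T, F (x + b * Complex.I))
      + Complex.I • (∫ y in a..b, F (T + y * Complex.I))
      - Complex.I • (∫ y in a..b, F ((-T : ℝ) + y * Complex.I)) = 0 := by
    intro T
    have := Complex.integral_boundary_rect_eq_zero_of_differentiable_on_off_countable F
      (⟨-T, a⟩ : ℂ) (⟨T, b⟩ : ℂ) {0} (Set.countable_singleton _) ?_ ?_
    · simpa using this
    · intro z hz
      have h2 := hz.2
      simp only [Set.mem_preimage, Set.uIcc_of_le hab] at h2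
      exact (hc z h2.1 h2.2).continuousWithinAt
    · intro z hz
      have h2 := hz.1.2
      simp only [Set.mem_preimage, min_eq_left hab, max_eq_right hab] at h2
      exact hd z h2.1.le h2.2.le hz.2
  have hlim := (((intervalIntegral_tendsto_integral (hint a le_rfl hab) tendsto_neg_atTop_atBot
    tendsto_id).sub (intervalIntegral_tendsto_integral (hint b hab le_rfl) tendsto_neg_atTop_atBot
    tendsto_id)).add (tendsto_vertical_integral (φ := fun T => T) hab
      ((eventually_ge_atTop 1).mono fun T hT => hT.trans (le_abs_self T)) (fun _ => rfl) hC)).sub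
      (tendsto_vertical_integral (φ := fun T => -T) hab
      ((eventually_ge_atTop 1).mono fun T hT => by
        rw [abs_neg]
        exact hT.trans (le_abs_self T)) (fun T => abs_neg T) hC)
  have h0 := tendsto_nhds_unique hlim
    (tendsto_const_nhds.congr fun T => (hrect T).symm)
  simpa [sub_eq_zero] using h0

/-- Cauchy's theorem in a strip. -/
lemma integral_line_eq {F : ℂ → ℂ} {a b C : ℝ} (hab : a ≤ b)
    (hd : ∀ z : ℂ, a ≤ z.im → z.im ≤ b → DifferentiableAt ℂ F z)
    (hC : ∀ z : ℂ, a ≤ z.im → z.im ≤ b → 1 ≤ |z.re| → ‖F z‖ ≤ C * (Real.cosh z.re)⁻¹) :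
    ∫ x : ℝ, F (x + a * Complex.I) = ∫ x : ℝ, F (x + b * Complex.I) :=
  integral_line_eq_of_continuous hab (fun z h1 h2 => (hd z h1 h2).continuousAt)
    (fun z h1 h2 _ => hd z h1 h2) hC

lemma sin_ne_zero_of_mem {y : ℝ} (h0 : y ≠ 0) (h1 : -Real.pi < y) (h2 : y < Real.pi) :
    Real.sin y ≠ 0 := by
  rw [Ne, Real.sin_eq_zero_iff_of_lt_of_lt h1 h2]
  exact h0

/-- Growth like cosh((κ−1)x) in the numerator is what the denominator absorbs while leaving a factor
1/cosh x. At κ = 1, the case of the diagonal pole, the numerator is just bounded. -/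
lemma norm_div_sinh_le {κ C : ℝ} (hκ : 1 ≤ κ) {z w : ℂ} (hz : 1 ≤ |z.re|)
    (hw : ‖w‖ ≤ C * Real.cosh ((κ - 1) * z.re)) :
    ‖w / Complex.sinh (κ * z)‖ ≤ C / Real.tanh κ * (Real.cosh z.re)⁻¹ := by
  have hκ0 : 0 < κ := by linarith
  have ht : 0 < Real.tanh κ := by
    rw [Real.tanh_eq_sinh_div_cosh]
    exact div_pos (Real.sinh_pos_iff.2 hκ0) (Real.cosh_pos _)
  have hC : 0 ≤ C := by
    by_contra! h
    have := mul_neg_of_neg_of_pos h (Real.cosh_pos ((κ - 1) * z.re))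
    linarith [norm_nonneg w]
  have h1 : Real.tanh κ * Real.cosh (κ * z.re) ≤ ‖Complex.sinh (κ * z)‖ := by
    refine (tanh_mul_cosh_le hκ0 hz).trans ?_
    simpa using abs_sinh_re_le_norm_sinh (κ * z)
  have hpos : 0 < Real.tanh κ * Real.cosh (κ * z.re) := mul_pos ht (Real.cosh_pos _)
  rw [norm_div, ← div_eq_mul_inv, div_div, div_le_div_iff₀ (hpos.trans_le h1)
    (mul_pos ht (Real.cosh_pos _))]
  calc ‖w‖ * (Real.tanh κ * Real.cosh z.re)
      ≤ C * Real.cosh ((κ - 1) * z.re) * (Real.tanh κ * Real.cosh z.re) := by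
        gcongr
    _ = C * (Real.tanh κ * (Real.cosh ((κ - 1) * z.re) * Real.cosh z.re)) := by ring
    _ ≤ C * (Real.tanh κ * Real.cosh (κ * z.re)) := by
        gcongr
        exact cosh_mul_cosh_le hκ _
    _ ≤ C * ‖Complex.sinh (κ * z)‖ := by gcongr

/-- The integral of `1 / sinh (κ z)` along a horizontal line just above the real axis. -/
lemma integral_inv_sinh_of_pos {κ y : ℝ} (hκ : 1 ≤ κ) (h0 : 0 < y) (h1 : κ * y < Real.pi) :
    ∫ x : ℝ, 1 / Complex.sinh (κ * (x + y * Complex.I)) = -(Complex.I * Real.pi / κ) := by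
  have hκ0 : 0 < κ := by linarith
  have key : ∀ a b : ℝ, 0 < a → κ * b < Real.pi → a ≤ b →
      ∫ x : ℝ, 1 / Complex.sinh (κ * (x + a * Complex.I))
        = ∫ x : ℝ, 1 / Complex.sinh (κ * (x + b * Complex.I)) := by
    intro a b ha hb hab
    refine integral_line_eq (F := fun z => 1 / Complex.sinh (κ * z)) (C := 1 / Real.tanh κ) hab
      (fun z h1 h2 => ?_) fun z _ _ hz => norm_div_sinh_le hκ hz ?_
    · refine DifferentiableAt.div (by fun_prop) (by fun_prop) (sinh_ne_zero_of_sin_im ?_)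
      have h3 : 0 < κ * z.im := mul_pos hκ0 (by linarith)
      have h4 : κ * z.im ≤ κ * b := mul_le_mul_of_nonneg_left h2 hκ0.le
      simpa using (Real.sin_pos_of_pos_of_lt_pi h3 (by linarith)).ne'
    · simp
  -- At height π/(2κ), halfway between two zeros, sinh(κz) = i cosh(κx), and the integral of 1/cosh
  -- is π.
  have hm : ∫ x : ℝ, 1 / Complex.sinh (κ * (x + (Real.pi / 2 / κ : ℝ) * Complex.I))
      = -(Complex.I * Real.pi / κ) := by
    have h : ∀ x : ℝ, 1 / Complex.sinh (κ * (x + (Real.pi / 2 / κ : ℝ) * Complex.I))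
        = -Complex.I * (((Real.cosh (κ * x))⁻¹ : ℝ) : ℂ) := by
      intro x
      have : (κ : ℂ) * (x + (Real.pi / 2 / κ : ℝ) * Complex.I)
          = ((κ * x : ℝ) : ℂ) + (Real.pi / 2 : ℂ) * Complex.I := by
        have : (κ : ℂ) ≠ 0 := by exact_mod_cast hκ0.ne'
        push_cast
        field_simp
      rw [this, Complex.sinh_add, Complex.sinh_mul_I, Complex.cosh_mul_I, Complex.sin_pi_div_two,
        Complex.cos_pi_div_two]
      push_cast
      simp [mul_comm]
    simp_rw [h]
    rw [integral_const_mul, integral_complex_ofReal,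
      Measure.integral_comp_mul_left (fun x => (Real.cosh x)⁻¹) κ, integral_inv_cosh,
      abs_of_pos (inv_pos.2 hκ0)]
    simp only [smul_eq_mul]
    push_cast
    ring
  have hpi := Real.pi_pos
  have h3 : 0 < Real.pi / 2 / κ := by positivity
  have h4 : κ * (Real.pi / 2 / κ) < Real.pi := by
    rw [mul_div_cancel₀ _ hκ0.ne']
    linarith
  rcases le_total y (Real.pi / 2 / κ) with h | h
  · rw [key _ _ h0 h4 h, hm]
  · rw [← key _ _ h3 h1 h, hm]

lemma integral_inv_sinh_of_neg {κ y : ℝ} (hκ : 1 ≤ κ) (h0 : y < 0) (h1 : -Real.pi < κ * y) :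
    ∫ x : ℝ, 1 / Complex.sinh (κ * (x + y * Complex.I)) = Complex.I * Real.pi / κ := by
  have h := integral_inv_sinh_of_pos hκ (neg_pos.2 h0) (by linarith)
  rw [← integral_neg_eq_self]
  have h2 : ∀ x : ℝ, 1 / Complex.sinh (κ * ((-x : ℝ) + y * Complex.I))
      = -(1 / Complex.sinh (κ * (x + (-y : ℝ) * Complex.I))) := by
    intro x
    rw [← div_neg, ← Complex.sinh_neg]
    congr 2
    push_cast
    ring
  simp_rw [h2]
  rw [integral_neg, h, neg_neg]

/-- The residue theorem in a strip, for a simple pole at the origin. -/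
lemma integral_line_sub_integral_line {κ a b C : ℝ} (hκ : 1 ≤ κ) (ha : a < 0) (hb : 0 < b)
    (ha' : -Real.pi < κ * a) (hb' : κ * b < Real.pi) {g : ℂ → ℂ}
    (hg : ∀ z : ℂ, a ≤ z.im → z.im ≤ b → DifferentiableAt ℂ g z)
    (hC : ∀ z : ℂ, a ≤ z.im → z.im ≤ b → 1 ≤ |z.re| → ‖g z‖ ≤ C * Real.cosh ((κ - 1) * z.re)) :
    (∫ x : ℝ, g (x + b * Complex.I) / Complex.sinh (κ * (x + b * Complex.I)))
      - ∫ x : ℝ, g (x + a * Complex.I) / Complex.sinh (κ * (x + a * Complex.I))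
      = -(2 * Real.pi * Complex.I / κ * g 0) := by
  have hκ0 : 0 < κ := by linarith
  have hκc : (κ : ℂ) ≠ 0 := by exact_mod_cast hκ0.ne'
  have hsne : ∀ z : ℂ, a ≤ z.im → z.im ≤ b → z ≠ 0 → Complex.sinh (κ * z) ≠ 0 := by
    intro z h1 h2 hz
    by_cases hi : z.im = 0
    · refine sinh_ne_zero_of_re ?_
      have : z.re ≠ 0 := fun h => hz (Complex.ext h hi)
      simpa using ⟨hκ0.ne', this⟩
    · refine sinh_ne_zero_of_sin_im ?_
      have h3 := mul_le_mul_of_nonneg_left h1 hκ0.le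
      have h4 := mul_le_mul_of_nonneg_left h2 hκ0.le
      have : (κ * z).im = κ * z.im := by simp
      rw [this]
      exact sin_ne_zero_of_mem (mul_ne_zero hκ0.ne' hi) (by linarith) (by linarith)
  have hsd : ∀ z : ℂ, HasDerivAt (fun w : ℂ => Complex.sinh (κ * w)) (Complex.cosh (κ * z) * κ) z := by
    intro z
    simpa using (((hasDerivAt_id z).const_mul (κ : ℂ)).csinh)
  -- `s` extends sinh(κz)/z and `φ` extends (g(z) − g(0))/sinh(κz) across the origin, so Cauchy's
  -- theorem applies to `φ`. The subtracted part g(0)/sinh(κz) is integrated explicitly on both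
  -- lines.
  set s : ℂ → ℂ := dslope (fun w : ℂ => Complex.sinh (κ * w)) 0 with hs
  have hs0 : s 0 = κ := by
    rw [hs, dslope_same, (hsd 0).deriv]
    simp
  have hsz : ∀ z : ℂ, z ≠ 0 → s z = z⁻¹ * Complex.sinh (κ * z) := by
    intro z hz
    rw [hs, dslope_of_ne _ hz, slope_def_field]
    simp [div_eq_inv_mul]
  set φ : ℂ → ℂ := fun z => dslope g 0 z / s z with hφ
  have hφz : ∀ z : ℂ, z ≠ 0 → φ z = (g z - g 0) / Complex.sinh (κ * z) := by
    intro z hz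
    simp only [hφ]
    rw [hsz z hz, dslope_of_ne _ hz, slope_def_field, sub_zero]
    field_simp
  have hs_ne : ∀ z : ℂ, a ≤ z.im → z.im ≤ b → s z ≠ 0 := by
    intro z h1 h2
    by_cases hz : z = 0
    · rw [hz, hs0]
      exact hκc
    · rw [hsz z hz]
      exact mul_ne_zero (inv_ne_zero hz) (hsne z h1 h2 hz)
  have hsc : ∀ z, ContinuousAt s z := by
    intro z
    by_cases hz : z = 0
    · rw [hz, hs, continuousAt_dslope_same]
      exact (hsd 0).differentiableAt
    · exact ((differentiableAt_dslope_of_ne hz).2 (hsd z).differentiableAt).continuousAt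
  have hbound : ∀ z : ℂ, a ≤ z.im → z.im ≤ b → 1 ≤ |z.re| →
      ‖φ z‖ ≤ (C + ‖g 0‖) / Real.tanh κ * (Real.cosh z.re)⁻¹ := by
    intro z h1 h2 h3
    have hz : z ≠ 0 := by
      rintro rfl
      norm_num at h3
    rw [hφz z hz]
    refine norm_div_sinh_le hκ h3 ((norm_sub_le _ _).trans ?_)
    rw [add_mul]
    exact add_le_add (hC z h1 h2 h3) (le_mul_of_one_le_right (norm_nonneg _) (Real.one_le_cosh _))
  have hshift := integral_line_eq_of_continuous (F := φ) (ha.le.trans hb.le)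
    (fun z h1 h2 => by
      refine ContinuousAt.div₀ ?_ (hsc z) (hs_ne z h1 h2)
      by_cases hz : z = 0
      · rw [hz, continuousAt_dslope_same]
        exact hg 0 (by simpa using ha.le) (by simpa using hb.le)
      · exact ((differentiableAt_dslope_of_ne hz).2 (hg z h1 h2)).continuousAt)
    (fun z h1 h2 hz => DifferentiableAt.div ((differentiableAt_dslope_of_ne hz).2 (hg z h1 h2))
      ((differentiableAt_dslope_of_ne hz).2 (hsd z).differentiableAt) (hs_ne z h1 h2)) hbound
  have hline : ∀ y : ℝ, a ≤ y → y ≤ b → y ≠ 0 →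
      ∫ x : ℝ, φ (x + y * Complex.I)
        = (∫ x : ℝ, g (x + y * Complex.I) / Complex.sinh (κ * (x + y * Complex.I)))
          - g 0 * ∫ x : ℝ, 1 / Complex.sinh (κ * (x + y * Complex.I)) := by
    intro y h1 h2 h0
    have hne : ∀ x : ℝ, (x : ℂ) + y * Complex.I ≠ 0 := by
      intro x h
      apply h0
      simpa using congrArg Complex.im h
    have hI : ∀ f : ℂ → ℂ, ∀ C' : ℝ, (∀ z : ℂ, a ≤ z.im → z.im ≤ b → ContinuousAt f z) →
        (∀ z : ℂ, a ≤ z.im → z.im ≤ b → 1 ≤ |z.re| → ‖f z‖ ≤ C' * Real.cosh ((κ - 1) * z.re)) →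
        Integrable fun x : ℝ => f (x + y * Complex.I) / Complex.sinh (κ * (x + y * Complex.I)) := by
      intro f C' hf hfC
      refine integrable_of_le_inv_cosh (C := C' / Real.tanh κ) ?_ fun x hx => ?_
      · refine Continuous.div ?_ (by fun_prop) fun x =>
          hsne _ (by simpa using h1) (by simpa using h2) (hne x)
        rw [continuous_iff_continuousAt]
        intro x
        exact ContinuousAt.comp (g := f) (f := fun x : ℝ => (x : ℂ) + y * Complex.I)
          (hf _ (by simpa using h1) (by simpa using h2)) (by fun_prop)
      · have := norm_div_sinh_le (z := x + y * Complex.I) hκ (by simpa using hx)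
          (hfC (x + y * Complex.I) (by simpa using h1) (by simpa using h2) (by simpa using hx))
        simpa using this
    rw [← integral_const_mul, ← integral_sub
      (hI g C (fun z h1 h2 => (hg z h1 h2).continuousAt) hC)
      ((hI (fun _ => 1) 1 (fun _ _ _ => continuousAt_const)
        (fun z _ _ _ => by simp)).const_mul (g 0))]
    refine integral_congr_ae (.of_forall fun x => ?_)
    simp only
    rw [hφz _ (hne x)]
    ring
  rw [hline a le_rfl (ha.le.trans hb.le) ha.ne, hline b (ha.le.trans hb.le) le_rfl hb.ne',
    integral_inv_sinh_of_pos hκ hb hb', integral_inv_sinh_of_neg hκ ha ha'] at hshift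
  linear_combination -hshift

/-! ### The double contour integrals -/

/-- The one-variable factor `sinh (z + iθ) / sinh (κ z)`. -/
def kern (κ θ : ℝ) (z : ℂ) : ℂ := Complex.sinh (z + θ * Complex.I) / Complex.sinh (κ * z)

/-- The two-variable integrand with coupling `1 / sinh (z₁ - z₀ + ic)`. -/
def pair (κ θ₀ θ₁ c : ℝ) (z₀ z₁ : ℂ) : ℂ :=
  kern κ θ₀ z₀ * kern κ θ₁ z₁ / Complex.sinh (z₁ - z₀ + c * Complex.I)

/-- The integral of `pair` over the horizontal lines of heights `y₀` and `y₁`. -/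
def pairIntegral (κ θ₀ θ₁ c y₀ y₁ : ℝ) : ℂ :=
  ∫ x₀ : ℝ, ∫ x₁ : ℝ, pair κ θ₀ θ₁ c (x₀ + y₀ * Complex.I) (x₁ + y₁ * Complex.I)

/-- Here κ ≥ 2 is used: cosh² x ≤ cosh(κx), so one factor cosh x pays for the numerator and the
other remains as decay. -/
lemma norm_kern_le {κ : ℝ} (hκ : 2 ≤ κ) (θ : ℝ) {z : ℂ} (hz : Real.sin (κ * z.im) ≠ 0) :
    ‖kern κ θ z‖ ≤ |Real.sin (κ * z.im)|⁻¹ * (Real.cosh z.re)⁻¹ := by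
  have h1 : ‖Complex.sinh (z + θ * Complex.I)‖ ≤ Real.cosh z.re := by
    simpa using norm_sinh_le (z + θ * Complex.I)
  have h2 : |Real.sin (κ * z.im)| * Real.cosh (κ * z.re) ≤ ‖Complex.sinh (κ * z)‖ := by
    simpa using abs_sin_mul_cosh_le_norm_sinh (κ * z)
  have h3 := abs_pos.2 hz
  have h4 := Real.cosh_pos z.re
  have h5 := cosh_sq_le_cosh_mul hκ z.re
  rw [kern, norm_div, ← mul_inv, ← one_div, div_le_div_iff₀ ((mul_pos h3 (Real.cosh_pos _)).trans_le h2)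
    (mul_pos h3 h4), one_mul]
  calc _ ≤ Real.cosh z.re * (|Real.sin (κ * z.im)| * Real.cosh z.re) := by gcongr
    _ = |Real.sin (κ * z.im)| * (Real.cosh z.re * Real.cosh z.re) := by ring
    _ ≤ |Real.sin (κ * z.im)| * Real.cosh (κ * z.re) := by gcongr
    _ ≤ _ := h2

/-- The coupling contributes only a bounded factor; the decay in both variables comes from the two
kernels. This is the dominating bound behind Fubini, the contour moves and the limit in the
regulator. -/
lemma norm_pair_le {κ : ℝ} (hκ : 2 ≤ κ) (θ₀ θ₁ c : ℝ) {z₀ z₁ : ℂ}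
    (h₀ : Real.sin (κ * z₀.im) ≠ 0) (h₁ : Real.sin (κ * z₁.im) ≠ 0)
    (h : Real.sin (z₁.im - z₀.im + c) ≠ 0) :
    ‖pair κ θ₀ θ₁ c z₀ z₁‖ ≤ |Real.sin (κ * z₀.im)|⁻¹ * |Real.sin (κ * z₁.im)|⁻¹ *
      |Real.sin (z₁.im - z₀.im + c)|⁻¹ * ((Real.cosh z₀.re)⁻¹ * (Real.cosh z₁.re)⁻¹) := by
  have h3 : |Real.sin (z₁.im - z₀.im + c)| ≤ ‖Complex.sinh (z₁ - z₀ + c * Complex.I)‖ := by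
    simpa using abs_sin_le_norm_sinh (z₁ - z₀ + c * Complex.I)
  have h4 := mul_le_mul (norm_kern_le hκ θ₀ h₀) (norm_kern_le hκ θ₁ h₁) (norm_nonneg _)
    (mul_nonneg (inv_nonneg.2 (abs_nonneg _)) (inv_cosh_pos _).le)
  rw [pair, norm_div, norm_mul, div_eq_mul_inv]
  refine (mul_le_mul h4 (inv_anti₀ (abs_pos.2 h) h3) (inv_nonneg.2 (norm_nonneg _)) ?_).trans
    (le_of_eq (by ring))
  exact (mul_nonneg (norm_nonneg _) (norm_nonneg _)).trans h4

lemma sinh_mul_line_ne_zero {κ y : ℝ} (h : Real.sin (κ * y) ≠ 0) (x : ℝ) :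
    Complex.sinh (κ * (x + y * Complex.I)) ≠ 0 :=
  sinh_ne_zero_of_sin_im (by simpa using h)

lemma continuous_pair {κ y₀ y₁ c : ℝ} (θ₀ θ₁ : ℝ) (h₀ : Real.sin (κ * y₀) ≠ 0)
    (h₁ : Real.sin (κ * y₁) ≠ 0) (h : Real.sin (y₁ - y₀ + c) ≠ 0) :
    Continuous fun p : ℝ × ℝ =>
      pair κ θ₀ θ₁ c (p.1 + y₀ * Complex.I) (p.2 + y₁ * Complex.I) := by
  unfold pair kern
  refine Continuous.div (Continuous.mul (Continuous.div (by fun_prop) (by fun_prop) fun p =>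
    sinh_mul_line_ne_zero h₀ p.1) (Continuous.div (by fun_prop) (by fun_prop) fun p =>
    sinh_mul_line_ne_zero h₁ p.2)) (by fun_prop) fun p => sinh_ne_zero_of_sin_im (by simpa using h)

lemma norm_pair_line_le {κ : ℝ} (hκ : 2 ≤ κ) (θ₀ θ₁ : ℝ) {y₀ y₁ c : ℝ}
    (h₀ : Real.sin (κ * y₀) ≠ 0) (h₁ : Real.sin (κ * y₁) ≠ 0)
    (h : Real.sin (y₁ - y₀ + c) ≠ 0) (x₀ x₁ : ℝ) :
    ‖pair κ θ₀ θ₁ c (x₀ + y₀ * Complex.I) (x₁ + y₁ * Complex.I)‖ ≤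
      |Real.sin (κ * y₀)|⁻¹ * |Real.sin (κ * y₁)|⁻¹ *
      |Real.sin (y₁ - y₀ + c)|⁻¹ * ((Real.cosh x₀)⁻¹ * (Real.cosh x₁)⁻¹) := by
  simpa using norm_pair_le (z₀ := x₀ + y₀ * Complex.I) (z₁ := x₁ + y₁ * Complex.I) (c := c) hκ θ₀ θ₁
    (by simpa using h₀) (by simpa using h₁) (by simpa using h)

lemma integrable_inv_cosh_mul :
    Integrable fun p : ℝ × ℝ => (Real.cosh p.1)⁻¹ * (Real.cosh p.2)⁻¹ :=
  integrable_inv_cosh.mul_prod integrable_inv_cosh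

lemma integrable_pair {κ : ℝ} (hκ : 2 ≤ κ) (θ₀ θ₁ : ℝ) {y₀ y₁ c : ℝ}
    (h₀ : Real.sin (κ * y₀) ≠ 0) (h₁ : Real.sin (κ * y₁) ≠ 0)
    (h : Real.sin (y₁ - y₀ + c) ≠ 0) :
    Integrable fun p : ℝ × ℝ =>
      pair κ θ₀ θ₁ c (p.1 + y₀ * Complex.I) (p.2 + y₁ * Complex.I) :=
  (integrable_inv_cosh_mul.const_mul _).mono' (continuous_pair θ₀ θ₁ h₀ h₁ h).aestronglyMeasurable
    (.of_forall fun p => norm_pair_line_le hκ θ₀ θ₁ h₀ h₁ h p.1 p.2)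

/-- Together with Fubini, this reduces every move of the outer contour to a move of the inner one.
-/
lemma pair_swap (κ θ₀ θ₁ c : ℝ) (z₀ z₁ : ℂ) :
    pair κ θ₀ θ₁ c z₀ z₁ = -pair κ θ₁ θ₀ (-c) z₁ z₀ := by
  have : z₁ - z₀ + c * Complex.I = -(z₀ - z₁ + (-c : ℝ) * Complex.I) := by
    push_cast
    ring
  rw [pair, pair, this, Complex.sinh_neg, div_neg, mul_comm (kern κ θ₀ z₀)]

/-- The two variables may be interchanged. -/
lemma pairIntegral_swap {κ : ℝ} (hκ : 2 ≤ κ) (θ₀ θ₁ : ℝ) {y₀ y₁ c : ℝ}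
    (h₀ : Real.sin (κ * y₀) ≠ 0) (h₁ : Real.sin (κ * y₁) ≠ 0)
    (h : Real.sin (y₁ - y₀ + c) ≠ 0) :
    pairIntegral κ θ₀ θ₁ c y₀ y₁ = -pairIntegral κ θ₁ θ₀ (-c) y₁ y₀ := by
  rw [pairIntegral, integral_integral_swap (integrable_pair hκ θ₀ θ₁ h₀ h₁ h), pairIntegral,
    ← integral_neg]
  simp_rw [← integral_neg]
  simp_rw [pair_swap κ θ₀ θ₁ c]

lemma exists_pos_le_abs_of_continuousOn {f : ℝ → ℝ} {a b : ℝ} (hf : Continuous f)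
    (h : ∀ t, a ≤ t → t ≤ b → f t ≠ 0) : ∃ δ > 0, ∀ t, a ≤ t → t ≤ b → δ ≤ |f t| := by
  rcases le_or_gt a b with hab | hab
  · obtain ⟨t, ht, hm⟩ := isCompact_Icc.exists_isMinOn (Set.nonempty_Icc.2 hab)
      (hf.abs.continuousOn (s := Set.Icc a b))
    exact ⟨|f t|, abs_pos.2 (h t ht.1 ht.2), fun s h1 h2 => hm ⟨h1, h2⟩⟩
  · exact ⟨1, one_pos, fun t h1 h2 => absurd (h1.trans h2) hab.not_ge⟩

/-- Moving the inner contour without meeting a pole. -/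
lemma pairIntegral_shift_right {κ : ℝ} (hκ : 2 ≤ κ) (θ₀ θ₁ : ℝ) {y₀ c a b : ℝ}
    (hab : a ≤ b) (h₀ : Real.sin (κ * y₀) ≠ 0)
    (h₁ : ∀ t, a ≤ t → t ≤ b → Real.sin (κ * t) ≠ 0)
    (h : ∀ t, a ≤ t → t ≤ b → Real.sin (t - y₀ + c) ≠ 0) :
    pairIntegral κ θ₀ θ₁ c y₀ a = pairIntegral κ θ₀ θ₁ c y₀ b := by
  obtain ⟨δ₁, hδ₁, hδ₁'⟩ := exists_pos_le_abs_of_continuousOn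
    (f := fun t => Real.sin (κ * t)) (by fun_prop) h₁
  obtain ⟨δ, hδ, hδ'⟩ := exists_pos_le_abs_of_continuousOn
    (f := fun t => Real.sin (t - y₀ + c)) (by fun_prop) h
  unfold pairIntegral
  congr 1
  ext x₀
  refine integral_line_eq (F := fun z => pair κ θ₀ θ₁ c (x₀ + y₀ * Complex.I) z)
    (C := |Real.sin (κ * y₀)|⁻¹ * δ₁⁻¹ * δ⁻¹ * (Real.cosh x₀)⁻¹) hab (fun z h1 h2 => ?_)
    fun z h1 h2 _ => ?_
  · unfold pair kern
    refine DifferentiableAt.div (DifferentiableAt.mul (by fun_prop)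
      (DifferentiableAt.div (by fun_prop) (by fun_prop) (sinh_ne_zero_of_sin_im ?_)))
      (by fun_prop) (sinh_ne_zero_of_sin_im ?_)
    · simpa using h₁ _ h1 h2
    · simpa using h _ h1 h2
  · have h3 := norm_pair_le (z₀ := x₀ + y₀ * Complex.I) (z₁ := z) (c := c) hκ θ₀ θ₁
      (by simpa using h₀) (h₁ _ h1 h2) (by simpa using h _ h1 h2)
    refine h3.trans ?_
    have e1 : ((x₀ : ℂ) + y₀ * Complex.I).im = y₀ := by simp
    have e2 : ((x₀ : ℂ) + y₀ * Complex.I).re = x₀ := by simp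
    rw [e1, e2, ← mul_assoc]
    have i1 := inv_cosh_pos x₀
    have i2 := inv_cosh_pos z.re
    have i3 := hδ₁' _ h1 h2
    have i4 := hδ' _ h1 h2
    gcongr

lemma norm_sinh_div_sinh_le {θ₁ y₀ c a b δ : ℝ} (hδ : 0 < δ)
    (h : ∀ t, a ≤ t → t ≤ b → δ ≤ |Real.sin (t - y₀ + c)|) (x₀ : ℝ) {z : ℂ} (h1 : a ≤ z.im)
    (h2 : z.im ≤ b) :
    ‖Complex.sinh (z + θ₁ * Complex.I) /
      Complex.sinh (z - (x₀ + y₀ * Complex.I) + c * Complex.I)‖ ≤ Real.cosh z.re / δ := by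
  have h3 : ‖Complex.sinh (z + θ₁ * Complex.I)‖ ≤ Real.cosh z.re := by
    simpa using norm_sinh_le (z + θ₁ * Complex.I)
  have h4 : |Real.sin (z.im - y₀ + c)|
      ≤ ‖Complex.sinh (z - (x₀ + y₀ * Complex.I) + c * Complex.I)‖ := by
    simpa using abs_sin_le_norm_sinh (z - (x₀ + y₀ * Complex.I) + c * Complex.I)
  rw [norm_div]
  exact div_le_div₀ (Real.cosh_pos _).le h3 hδ ((h _ h1 h2).trans h4)

/-- Moving the inner contour across the pole of `1 / sinh (κ z₁)` at the origin. -/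
lemma pairIntegral_cross_right {κ : ℝ} (hκ : 2 ≤ κ) (θ₀ θ₁ : ℝ) {y₀ c a b : ℝ}
    (ha : a < 0) (hb : 0 < b) (ha' : -Real.pi < κ * a) (hb' : κ * b < Real.pi)
    (h₀ : Real.sin (κ * y₀) ≠ 0)
    (h : ∀ t, a ≤ t → t ≤ b → Real.sin (t - y₀ + c) ≠ 0) :
    pairIntegral κ θ₀ θ₁ c y₀ b = pairIntegral κ θ₀ θ₁ c y₀ a
      - 2 * Real.pi * Complex.I / κ * (Complex.sinh (θ₁ * Complex.I) *
        ∫ x₀ : ℝ, kern κ θ₀ (x₀ + y₀ * Complex.I) /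
          Complex.sinh (-(x₀ + y₀ * Complex.I) + c * Complex.I)) := by
  have hκ0 : 0 < κ := by linarith
  obtain ⟨δ, hδ, hδ'⟩ := exists_pos_le_abs_of_continuousOn
    (f := fun t => Real.sin (t - y₀ + c)) (by fun_prop) h
  have hsa : Real.sin (κ * a) ≠ 0 :=
    sin_ne_zero_of_mem (mul_ne_zero hκ0.ne' ha.ne) ha'
      ((mul_neg_of_pos_of_neg hκ0 ha).trans Real.pi_pos)
  have hsb : Real.sin (κ * b) ≠ 0 :=
    sin_ne_zero_of_mem (mul_ne_zero hκ0.ne' hb.ne')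
      ((neg_lt_zero.2 Real.pi_pos).trans (mul_pos hκ0 hb)) hb'
  have inner : ∀ x₀ : ℝ,
      (∫ x₁ : ℝ, pair κ θ₀ θ₁ c (x₀ + y₀ * Complex.I) (x₁ + b * Complex.I))
      - ∫ x₁ : ℝ, pair κ θ₀ θ₁ c (x₀ + y₀ * Complex.I) (x₁ + a * Complex.I)
      = -(2 * Real.pi * Complex.I / κ * Complex.sinh (θ₁ * Complex.I)) *
        (kern κ θ₀ (x₀ + y₀ * Complex.I) /
          Complex.sinh (-(x₀ + y₀ * Complex.I) + c * Complex.I)) := by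
    intro x₀
    have hr := integral_line_sub_integral_line (κ := κ)
      (g := fun z => kern κ θ₀ (x₀ + y₀ * Complex.I) * (Complex.sinh (z + θ₁ * Complex.I) /
        Complex.sinh (z - (x₀ + y₀ * Complex.I) + c * Complex.I)))
      (C := ‖kern κ θ₀ (x₀ + y₀ * Complex.I)‖ * δ⁻¹) (by linarith) ha hb ha' hb' ?_ ?_
    · have e : ∀ y x₁ : ℝ, pair κ θ₀ θ₁ c (x₀ + y₀ * Complex.I) (x₁ + y * Complex.I)
          = kern κ θ₀ (x₀ + y₀ * Complex.I) *
            (Complex.sinh (x₁ + y * Complex.I + θ₁ * Complex.I) /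
            Complex.sinh (x₁ + y * Complex.I - (x₀ + y₀ * Complex.I) + c * Complex.I)) /
            Complex.sinh (κ * (x₁ + y * Complex.I)) := by
        intro y x₁
        rw [pair, kern.eq_1 κ θ₁]
        ring
      simp_rw [e]
      rw [hr]
      simp only [zero_add, zero_sub]
      ring
    · intro z h1 h2
      refine DifferentiableAt.mul (by fun_prop) (DifferentiableAt.div (by fun_prop) (by fun_prop)
        (sinh_ne_zero_of_sin_im ?_))
      simpa using h _ h1 h2
    · intro z h1 h2 _
      rw [norm_mul, mul_assoc]
      refine mul_le_mul_of_nonneg_left ((norm_sinh_div_sinh_le hδ hδ' x₀ h1 h2).trans ?_)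
        (norm_nonneg _)
      rw [div_eq_inv_mul]
      exact mul_le_mul_of_nonneg_left (cosh_le_cosh_mul (by linarith) _) (inv_nonneg.2 hδ.le)
  have hIb := (integrable_pair hκ θ₀ θ₁ h₀ hsb
    (h b (ha.le.trans hb.le) le_rfl)).integral_prod_left
  have hIa := (integrable_pair hκ θ₀ θ₁ h₀ hsa (h a le_rfl (ha.le.trans hb.le))).integral_prod_left
  have hsub := integral_sub hIb hIa
  simp_rw [inner] at hsub
  rw [integral_const_mul] at hsub
  unfold pairIntegral
  linear_combination -hsub

/-- Moving the inner contour across the pole on the diagonal. -/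
lemma pairIntegral_cross_diag {κ : ℝ} (hκ : 2 ≤ κ) (θ₀ θ₁ : ℝ) {y₀ a b : ℝ}
    (ha : a < y₀) (hb : y₀ < b) (ha' : -Real.pi < a - y₀) (hb' : b - y₀ < Real.pi)
    (h₁ : ∀ t, a ≤ t → t ≤ b → Real.sin (κ * t) ≠ 0) :
    pairIntegral κ θ₀ θ₁ 0 y₀ b = pairIntegral κ θ₀ θ₁ 0 y₀ a
      - 2 * Real.pi * Complex.I *
        ∫ x₀ : ℝ, kern κ θ₀ (x₀ + y₀ * Complex.I) * kern κ θ₁ (x₀ + y₀ * Complex.I) := by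
  have h₀ := h₁ y₀ ha.le hb.le
  obtain ⟨δ, hδ, hδ'⟩ := exists_pos_le_abs_of_continuousOn
    (f := fun t => Real.sin (κ * t)) (by fun_prop) h₁
  have inner : ∀ x₀ : ℝ,
      (∫ x₁ : ℝ, pair κ θ₀ θ₁ 0 (x₀ + y₀ * Complex.I) (x₁ + b * Complex.I))
      - ∫ x₁ : ℝ, pair κ θ₀ θ₁ 0 (x₀ + y₀ * Complex.I) (x₁ + a * Complex.I)
      = -(2 * Real.pi * Complex.I) *
        (kern κ θ₀ (x₀ + y₀ * Complex.I) * kern κ θ₁ (x₀ + y₀ * Complex.I)) := by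
    intro x₀
    have hr := integral_line_sub_integral_line (κ := 1)
      (g := fun z => kern κ θ₀ (x₀ + y₀ * Complex.I) * kern κ θ₁ (z + (x₀ + y₀ * Complex.I)))
      (C := ‖kern κ θ₀ (x₀ + y₀ * Complex.I)‖ * δ⁻¹) le_rfl (sub_neg.2 ha) (sub_pos.2 hb)
      (by simpa using ha') (by simpa using hb') ?_ ?_
    · have e : ∀ y : ℝ, ∫ x₁ : ℝ, pair κ θ₀ θ₁ 0 (x₀ + y₀ * Complex.I) (x₁ + y * Complex.I)
          = ∫ x : ℝ, kern κ θ₀ (x₀ + y₀ * Complex.I) *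
            kern κ θ₁ (x + (y - y₀ : ℝ) * Complex.I + (x₀ + y₀ * Complex.I)) /
            Complex.sinh ((1 : ℝ) * (x + (y - y₀ : ℝ) * Complex.I)) := by
        intro y
        -- Shifting x₁ by x₀ and measuring heights from y₀ places the diagonal pole at the origin.
        rw [← integral_add_right_eq_self _ x₀]
        congr 1
        ext x
        rw [pair]
        congr 2
        · congr 1
          push_cast
          ring
        · push_cast
          ring
      rw [e, e, hr]
      simp only [zero_add, Complex.ofReal_one, div_one]
      ring
    · intro z h1 h2
      unfold kern
      refine DifferentiableAt.mul (by fun_prop) (DifferentiableAt.div (by fun_prop) (by fun_prop)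
        (sinh_ne_zero_of_sin_im ?_))
      simpa using h₁ (z.im + y₀) (by linarith) (by linarith)
    · intro z h1 h2 _
      have h3 := hδ' (z.im + y₀) (by linarith) (by linarith)
      have h4 := norm_kern_le (z := z + (x₀ + y₀ * Complex.I)) hκ θ₁
        (by simpa using h₁ (z.im + y₀) (by linarith) (by linarith))
      have e1 : (z + (x₀ + y₀ * Complex.I)).im = z.im + y₀ := by simp
      rw [e1] at h4
      simp only [sub_self, zero_mul, Real.cosh_zero, mul_one, norm_mul]
      refine mul_le_mul_of_nonneg_left (h4.trans ?_) (norm_nonneg _)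
      calc _ ≤ |Real.sin (κ * (z.im + y₀))|⁻¹ * 1 :=
            mul_le_mul_of_nonneg_left (inv_le_one_of_one_le₀ (Real.one_le_cosh _))
              (inv_nonneg.2 (abs_nonneg _))
        _ ≤ δ⁻¹ := by
            rw [mul_one]
            exact inv_anti₀ hδ h3
  have hsa : Real.sin (a - y₀ + 0) ≠ 0 := by
    rw [add_zero]
    exact sin_ne_zero_of_mem (sub_neg.2 ha).ne ha' (by linarith [Real.pi_pos])
  have hsb : Real.sin (b - y₀ + 0) ≠ 0 := by
    rw [add_zero]
    exact sin_ne_zero_of_mem (sub_pos.2 hb).ne' (by linarith [Real.pi_pos]) hb'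
  have hab : a ≤ b := (ha.trans hb).le
  have hIb := (integrable_pair hκ θ₀ θ₁ h₀ (h₁ b hab le_rfl) hsb).integral_prod_left
  have hIa := (integrable_pair hκ θ₀ θ₁ h₀ (h₁ a le_rfl hab) hsa).integral_prod_left
  have hsub := integral_sub hIb hIa
  simp_rw [inner] at hsub
  rw [integral_const_mul] at hsub
  unfold pairIntegral
  linear_combination -hsub

/-- Moving the outer contour without meeting a pole. -/
lemma pairIntegral_shift_left {κ : ℝ} (hκ : 2 ≤ κ) (θ₀ θ₁ : ℝ) {y₁ c a b : ℝ}
    (hab : a ≤ b) (h₁ : Real.sin (κ * y₁) ≠ 0)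
    (h₀ : ∀ t, a ≤ t → t ≤ b → Real.sin (κ * t) ≠ 0)
    (h : ∀ t, a ≤ t → t ≤ b → Real.sin (y₁ - t + c) ≠ 0) :
    pairIntegral κ θ₀ θ₁ c a y₁ = pairIntegral κ θ₀ θ₁ c b y₁ := by
  rw [pairIntegral_swap hκ θ₀ θ₁ (h₀ a le_rfl hab) h₁ (h a le_rfl hab),
    pairIntegral_swap hκ θ₀ θ₁ (h₀ b hab le_rfl) h₁ (h b hab le_rfl),
    pairIntegral_shift_right hκ θ₁ θ₀ hab h₁ h₀]
  intro t h1 h2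
  rw [show t - y₁ + -c = -(y₁ - t + c) by ring, Real.sin_neg]
  exact neg_ne_zero.2 (h t h1 h2)

/-- Moving the outer contour across the pole of `1 / sinh (κ z₀)` at the origin. -/
lemma pairIntegral_cross_left {κ : ℝ} (hκ : 2 ≤ κ) (θ₀ θ₁ : ℝ) {y₁ c a b : ℝ}
    (ha : a < 0) (hb : 0 < b) (ha' : -Real.pi < κ * a) (hb' : κ * b < Real.pi)
    (h₁ : Real.sin (κ * y₁) ≠ 0)
    (h : ∀ t, a ≤ t → t ≤ b → Real.sin (y₁ - t + c) ≠ 0) :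
    pairIntegral κ θ₀ θ₁ c b y₁ = pairIntegral κ θ₀ θ₁ c a y₁
      - 2 * Real.pi * Complex.I / κ * (Complex.sinh (θ₀ * Complex.I) *
        ∫ x₁ : ℝ, kern κ θ₁ (x₁ + y₁ * Complex.I) /
          Complex.sinh (x₁ + y₁ * Complex.I + c * Complex.I)) := by
  have hκ0 : 0 < κ := by linarith
  have hsa : Real.sin (κ * a) ≠ 0 :=
    sin_ne_zero_of_mem (mul_ne_zero hκ0.ne' ha.ne) ha'
      ((mul_neg_of_pos_of_neg hκ0 ha).trans Real.pi_pos)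
  have hsb : Real.sin (κ * b) ≠ 0 :=
    sin_ne_zero_of_mem (mul_ne_zero hκ0.ne' hb.ne')
      ((neg_lt_zero.2 Real.pi_pos).trans (mul_pos hκ0 hb)) hb'
  have hab : a ≤ b := (ha.trans hb).le
  rw [pairIntegral_swap hκ θ₀ θ₁ hsa h₁ (h a le_rfl hab),
    pairIntegral_swap hκ θ₀ θ₁ hsb h₁ (h b hab le_rfl),
    pairIntegral_cross_right hκ θ₁ θ₀ ha hb ha' hb' h₁]
  · have e : ∀ x₁ : ℝ, kern κ θ₁ (x₁ + y₁ * Complex.I) /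
        Complex.sinh (-(x₁ + y₁ * Complex.I) + (-c : ℝ) * Complex.I)
        = -(kern κ θ₁ (x₁ + y₁ * Complex.I) /
          Complex.sinh (x₁ + y₁ * Complex.I + c * Complex.I)) := by
      intro x₁
      rw [← div_neg, ← Complex.sinh_neg]
      congr 2
      push_cast
      ring
    simp_rw [e, integral_neg]
    ring
  · intro t h1 h2
    rw [show t - y₁ + -c = -(y₁ - t + c) by ring, Real.sin_neg]
    exact neg_ne_zero.2 (h t h1 h2)

/-- Continuity in the regulator. -/
lemma continuousAt_pairIntegral {κ : ℝ} (hκ : 2 ≤ κ) (θ₀ θ₁ : ℝ) {y₀ y₁ c : ℝ}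
    (h₀ : Real.sin (κ * y₀) ≠ 0) (h₁ : Real.sin (κ * y₁) ≠ 0)
    (h : Real.sin (y₁ - y₀ + c) ≠ 0) :
    ContinuousAt (fun c' => pairIntegral κ θ₀ θ₁ c' y₀ y₁) c := by
  have hs : Continuous fun c' => |Real.sin (y₁ - y₀ + c')| := by fun_prop
  have hpos := abs_pos.2 h
  -- Near `c` the lower bound for the coupling keeps at least half its value, which gives a
  -- dominating function independent of `c'`.
  have hev : ∀ᶠ c' in 𝓝 c, |Real.sin (y₁ - y₀ + c)| / 2 < |Real.sin (y₁ - y₀ + c')| :=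
    hs.continuousAt.eventually (lt_mem_nhds (half_lt_self hpos))
  have hne : ∀ c', |Real.sin (y₁ - y₀ + c)| / 2 < |Real.sin (y₁ - y₀ + c')| →
      Real.sin (y₁ - y₀ + c') ≠ 0 := fun c' hc' => abs_pos.1 ((half_pos hpos).trans hc')
  have hprod : ContinuousAt (fun c' => ∫ p : ℝ × ℝ,
      pair κ θ₀ θ₁ c' (p.1 + y₀ * Complex.I) (p.2 + y₁ * Complex.I)) c := by
    refine continuousAt_of_dominated
      (bound := fun p => |Real.sin (κ * y₀)|⁻¹ * |Real.sin (κ * y₁)|⁻¹ *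
        (|Real.sin (y₁ - y₀ + c)| / 2)⁻¹ * ((Real.cosh p.1)⁻¹ * (Real.cosh p.2)⁻¹))
      ?_ ?_ (integrable_inv_cosh_mul.const_mul _) (.of_forall fun p => ?_)
    · filter_upwards [hev] with c' hc'
      exact (continuous_pair θ₀ θ₁ h₀ h₁ (hne c' hc')).aestronglyMeasurable
    · filter_upwards [hev] with c' hc'
      refine .of_forall fun p => (norm_pair_line_le hκ θ₀ θ₁ h₀ h₁ (hne c' hc') p.1 p.2).trans ?_
      have i1 := inv_cosh_pos p.1
      have i2 := inv_cosh_pos p.2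
      gcongr
    · unfold pair
      refine ContinuousAt.div (by fun_prop) (by fun_prop) (sinh_ne_zero_of_sin_im ?_)
      simpa using h
  refine hprod.congr ?_
  filter_upwards [hev] with c' hc'
  exact integral_prod _ (integrable_pair hκ θ₀ θ₁ h₀ h₁ (hne c' hc'))

/-! ### The one-dimensional integrals -/

lemma integrable_hyperbolic_div_cosh_sq {κ : ℝ} (hκ : 2 ≤ κ) {f : ℝ → ℝ} (hf : Continuous f)
    (hf' : ∀ x, |f x| ≤ Real.cosh (2 * x)) : Integrable fun x => f x / Real.cosh (κ * x) ^ 2 := by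
  have hpos : ∀ x, 0 < Real.cosh (κ * x) ^ 2 := fun x => pow_pos (Real.cosh_pos _) 2
  refine integrable_inv_cosh.mono' (Continuous.div hf (by fun_prop)
    fun x => (hpos x).ne').aestronglyMeasurable (.of_forall fun x => ?_)
  rw [norm_div, Real.norm_eq_abs, Real.norm_of_nonneg (hpos x).le, inv_eq_one_div,
    div_le_div_iff₀ (hpos x) (Real.cosh_pos x), one_mul, pow_two]
  refine mul_le_mul ((hf' x).trans ?_) (cosh_le_cosh_mul (by linarith) x) (Real.cosh_pos x).le
    (Real.cosh_pos _).le
  rw [Real.cosh_le_cosh, abs_mul, abs_mul]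
  exact mul_le_mul_of_nonneg_right (by rwa [abs_two, abs_of_pos (by linarith)]) (abs_nonneg x)

lemma abs_sinh_le_cosh (x : ℝ) : |Real.sinh x| ≤ Real.cosh x := by
  refine abs_le_of_sq_le_sq ?_ (Real.cosh_pos x).le
  rw [Real.cosh_sq]
  linarith

lemma integral_sinh_div_cosh_sq (κ : ℝ) :
    ∫ x : ℝ, Real.sinh (2 * x) / Real.cosh (κ * x) ^ 2 = 0 := by
  have h := integral_neg_eq_self (fun x : ℝ => Real.sinh (2 * x) / Real.cosh (κ * x) ^ 2) volume
  simp only [mul_neg, Real.sinh_neg, Real.cosh_neg, neg_div, integral_neg] at h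
  linarith

lemma integral_one_div_cosh_mul_sq {κ : ℝ} (hκ : 0 < κ) :
    ∫ x : ℝ, 1 / Real.cosh (κ * x) ^ 2 = 2 / κ := by
  simp_rw [one_div]
  rw [Measure.integral_comp_mul_left (fun x => (Real.cosh x ^ 2)⁻¹) κ, integral_inv_cosh_sq,
    abs_of_pos (inv_pos.2 hκ), smul_eq_mul]
  ring

/-- The value of `sinh (κ z) ^ 2` on the lines halfway between the zeros of `sinh (κ z)`. -/
lemma sinh_sq_half_period {κ ζ : ℝ} (h : κ * ζ = Real.pi) {y : ℝ} (hy : y = ζ / 2 ∨ y = -(ζ / 2))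
    (x : ℝ) : Complex.sinh (κ * (x + y * Complex.I)) ^ 2 = -(Real.cosh (κ * x) ^ 2 : ℝ) := by
  have e : (κ : ℂ) * (x + y * Complex.I) = ((κ * x : ℝ) : ℂ) + ((κ * y : ℝ) : ℂ) * Complex.I := by
    push_cast
    ring
  have h2 : Real.cos (κ * y) = 0 ∧ Real.sin (κ * y) ^ 2 = 1 := by
    rcases hy with rfl | rfl
    · rw [← mul_div_assoc, h]
      simp
    · rw [mul_neg, ← mul_div_assoc, h]
      simp
  rw [e, Complex.sinh_add, Complex.sinh_mul_I, Complex.cosh_mul_I, ← Complex.ofReal_cos,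
    ← Complex.ofReal_sin, h2.1, Complex.ofReal_zero, mul_zero, zero_add, mul_pow, mul_pow,
    Complex.I_sq, ← Complex.ofReal_pow, h2.2]
  push_cast
  ring

lemma dslope_sinh_mul (m : ℝ) : Differentiable ℂ (dslope (fun w : ℂ => Complex.sinh (m * w)) 0) ∧
    dslope (fun w : ℂ => Complex.sinh (m * w)) 0 0 = m ∧
    ∀ z : ℂ, z ≠ 0 → dslope (fun w : ℂ => Complex.sinh (m * w)) 0 z
      = z⁻¹ * Complex.sinh (m * z) := by
  refine ⟨?_, ?_, fun z hz => ?_⟩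
  · rw [← differentiableOn_univ, Complex.differentiableOn_dslope univ_mem]
    exact Differentiable.differentiableOn (by fun_prop)
  · have : HasDerivAt (fun w : ℂ => Complex.sinh (m * w)) (Complex.cosh (m * 0) * (m * 1)) 0 :=
      ((hasDerivAt_id (0 : ℂ)).const_mul (m : ℂ)).csinh
    rw [dslope_same, this.deriv]
    simp
  · rw [dslope_of_ne _ hz, slope_def_field]
    simp [div_eq_inv_mul]

lemma sin_mul_ne_zero {κ ζ t : ℝ} (hκ : 0 < κ) (h : κ * ζ = Real.pi) (h0 : t ≠ 0) (h1 : -ζ < t)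
    (h2 : t < ζ) : Real.sin (κ * t) ≠ 0 := by
  refine sin_ne_zero_of_mem (mul_ne_zero hκ.ne' h0) ?_ ?_
  · rw [← h, ← mul_neg]
    exact mul_lt_mul_of_pos_left h1 hκ
  · rw [← h]
    exact mul_lt_mul_of_pos_left h2 hκ

/-- Apply the residue theorem to sinh(2z)/sinh²(κz) between the lines Im z = ±ζ/2, where sinh²(κz) =
−cosh²(κx). On them sinh(2z) splits into an odd part, which integrates to zero, and ±i sin ζ ·
cosh(2x). The double zero of the denominator leaves a simple pole g/sinh(κz) with g =
sinh(2z)/sinh(κz) and g(0) = 2/κ; g is realized below as the quotient `p / q` of entire functions.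
-/
lemma integral_cosh_div_cosh_sq {κ ζ : ℝ} (hκ : 2 ≤ κ) (hζ : 0 < ζ) (h : κ * ζ = Real.pi)
    (hs : Real.sin ζ ≠ 0) :
    ∫ x : ℝ, Real.cosh (2 * x) / Real.cosh (κ * x) ^ 2 = 2 * ζ / (κ * Real.sin ζ) := by
  have hκ0 : 0 < κ := by linarith
  have hpi := Real.pi_pos
  obtain ⟨d2, d2z, d2n⟩ := dslope_sinh_mul 2
  obtain ⟨dk, dkz, dkn⟩ := dslope_sinh_mul κ
  set p := dslope (fun w : ℂ => Complex.sinh ((2 : ℝ) * w)) 0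
  set q := dslope (fun w : ℂ => Complex.sinh (κ * w)) 0
  have ht : 0 < Real.tanh κ := by
    rw [Real.tanh_eq_sinh_div_cosh]
    exact div_pos (Real.sinh_pos_iff.2 hκ0) (Real.cosh_pos _)
  have hpq : ∀ z : ℂ, z ≠ 0 → p z / q z = Complex.sinh ((2 : ℝ) * z) / Complex.sinh (κ * z) := by
    intro z hz
    rw [d2n z hz, dkn z hz, mul_div_mul_left _ _ (inv_ne_zero hz)]
  have hqne : ∀ z : ℂ, -(ζ / 2) ≤ z.im → z.im ≤ ζ / 2 → q z ≠ 0 := by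
    intro z h1 h2
    by_cases hz : z = 0
    · rw [hz, dkz]
      exact_mod_cast hκ0.ne'
    · rw [dkn z hz]
      refine mul_ne_zero (inv_ne_zero hz) ?_
      by_cases hi : z.im = 0
      · refine sinh_ne_zero_of_re ?_
        have : z.re ≠ 0 := fun h => hz (Complex.ext h hi)
        simpa using ⟨hκ0.ne', this⟩
      · refine sinh_ne_zero_of_sin_im ?_
        simpa using sin_mul_ne_zero hκ0 h hi (by linarith) (by linarith)
  have hb : κ * (ζ / 2) < Real.pi := by rw [← mul_div_assoc, h]; linarith
  have hr := integral_line_sub_integral_line (κ := κ) (g := fun z => p z / q z) (a := -(ζ / 2))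
    (b := ζ / 2) (C := 1 / Real.tanh κ) (by linarith) (by linarith) (by linarith)
    (by linarith) hb (fun z h1 h2 => (d2 z).div (dk z) (hqne z h1 h2)) ?_
  · have hint1 : Integrable fun x : ℝ => Real.sinh (2 * x) / Real.cosh (κ * x) ^ 2 :=
      integrable_hyperbolic_div_cosh_sq hκ (by fun_prop) fun x => abs_sinh_le_cosh _
    have hint2 : Integrable fun x : ℝ => Real.cosh (2 * x) / Real.cosh (κ * x) ^ 2 :=
      integrable_hyperbolic_div_cosh_sq hκ (by fun_prop) fun x => (abs_of_pos (Real.cosh_pos _)).le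
    have hline : ∀ y : ℝ, y = ζ / 2 ∨ y = -(ζ / 2) →
        ∫ x : ℝ, p (x + y * Complex.I) / q (x + y * Complex.I) /
          Complex.sinh (κ * (x + y * Complex.I))
        = -(Complex.I * Real.sin (2 * y)) *
          ((∫ x : ℝ, Real.cosh (2 * x) / Real.cosh (κ * x) ^ 2 : ℝ) : ℂ) := by
      intro y hy
      have hy0 : y ≠ 0 := by rcases hy with rfl | rfl <;> simp [hζ.ne']
      have e : ∀ x : ℝ, p (x + y * Complex.I) / q (x + y * Complex.I) /
          Complex.sinh (κ * (x + y * Complex.I))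
          = -(Real.cos (2 * y) : ℂ) * ((Real.sinh (2 * x) / Real.cosh (κ * x) ^ 2 : ℝ) : ℂ)
          + -(Complex.I * Real.sin (2 * y)) *
            ((Real.cosh (2 * x) / Real.cosh (κ * x) ^ 2 : ℝ) : ℂ) := by
        intro x
        have hne : (x : ℂ) + y * Complex.I ≠ 0 := by
          intro h'
          apply hy0
          simpa using congrArg Complex.im h'
        rw [hpq _ hne, div_div, ← pow_two, sinh_sq_half_period h hy]
        have e1 : ((2 : ℝ) : ℂ) * (x + y * Complex.I)
            = ((2 * x : ℝ) : ℂ) + ((2 * y : ℝ) : ℂ) * Complex.I := by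
          push_cast
          ring
        rw [e1, Complex.sinh_add, Complex.sinh_mul_I, Complex.cosh_mul_I]
        push_cast
        ring
      simp_rw [e]
      rw [integral_add (hint1.ofReal.const_mul _) (hint2.ofReal.const_mul _), integral_const_mul,
        integral_const_mul, integral_complex_ofReal, integral_complex_ofReal,
        integral_sinh_div_cosh_sq]
      simp
    rw [hline _ (.inl rfl), hline _ (.inr rfl)] at hr
    simp only [d2z, dkz] at hr
    rw [mul_neg, Real.sin_neg, mul_div_cancel₀ ζ two_ne_zero] at hr
    generalize (∫ x : ℝ, Real.cosh (2 * x) / Real.cosh (κ * x) ^ 2) = Y at hr ⊢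
    have hκc : (κ : ℂ) ≠ 0 := by exact_mod_cast hκ0.ne'
    have hsc : (Real.sin ζ : ℂ) ≠ 0 := by exact_mod_cast hs
    apply Complex.ofReal_injective
    rw [← h] at hr
    push_cast at hr hsc ⊢
    have hI := Complex.I_ne_zero
    field_simp at hr ⊢
    linear_combination (-1 / 2 : ℂ) * hr
  · intro z h1 h2 h3
    have hz : z ≠ 0 := by
      rintro rfl
      norm_num at h3
    have i1 : ‖Complex.sinh ((2 : ℝ) * z)‖ ≤ Real.cosh (κ * z.re) := by
      refine (norm_sinh_le _).trans ?_
      rw [Real.cosh_le_cosh, Complex.re_ofReal_mul, abs_mul, abs_mul]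
      exact mul_le_mul_of_nonneg_right (by rwa [abs_two, abs_of_pos (by linarith)]) (abs_nonneg _)
    have i2 : Real.tanh κ * Real.cosh (κ * z.re) ≤ ‖Complex.sinh (κ * z)‖ := by
      refine (tanh_mul_cosh_le hκ0 h3).trans ?_
      simpa using abs_sinh_re_le_norm_sinh (κ * z)
    have i3 := mul_pos ht (Real.cosh_pos (κ * z.re))
    rw [hpq z hz, norm_div]
    calc _ ≤ Real.cosh (κ * z.re) / (Real.tanh κ * Real.cosh (κ * z.re)) :=
          div_le_div₀ (Real.cosh_pos _).le i1 i3 i2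
      _ = 1 / Real.tanh κ := by
          have := Real.cosh_pos (κ * z.re)
          field_simp
      _ ≤ _ := le_mul_of_one_le_right (by positivity) (Real.one_le_cosh _)

/-- This is the contribution of the diagonal pole. By 2 sinh a sinh b = cosh(a+b) − cosh(a−b) and
sinh²(κz) = −cosh²(κx) on this line, the integrand is a combination of cosh 2x, sinh 2x and 1 over
cosh²(κx). -/
lemma integral_kern_mul_kern {κ ζ : ℝ} (hκ : 2 ≤ κ) (hζ : 0 < ζ) (h : κ * ζ = Real.pi)
    (hs : Real.sin ζ ≠ 0) (θ : ℝ) :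
    ∫ x : ℝ, kern κ θ (x + (-(ζ / 2) : ℝ) * Complex.I) * kern κ 0 (x + (-(ζ / 2) : ℝ) * Complex.I)
      = ((Real.cos θ / κ - Real.cos (θ - ζ) * ζ / (κ * Real.sin ζ) : ℝ) : ℂ) := by
  have hint1 : Integrable fun x : ℝ => Real.sinh (2 * x) / Real.cosh (κ * x) ^ 2 :=
    integrable_hyperbolic_div_cosh_sq hκ (by fun_prop) fun x => abs_sinh_le_cosh _
  have hint2 : Integrable fun x : ℝ => Real.cosh (2 * x) / Real.cosh (κ * x) ^ 2 :=
    integrable_hyperbolic_div_cosh_sq hκ (by fun_prop) fun x => (abs_of_pos (Real.cosh_pos _)).le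
  have hint3 : Integrable fun x : ℝ => 1 / Real.cosh (κ * x) ^ 2 :=
    integrable_hyperbolic_div_cosh_sq hκ (by fun_prop) fun x => by
      simp
  have e : ∀ x : ℝ,
      kern κ θ (x + (-(ζ / 2) : ℝ) * Complex.I) * kern κ 0 (x + (-(ζ / 2) : ℝ) * Complex.I)
      = -(Real.cos (θ - ζ) / 2 : ℂ) * ((Real.cosh (2 * x) / Real.cosh (κ * x) ^ 2 : ℝ) : ℂ)
        + -(Complex.I * Real.sin (θ - ζ) / 2) *
          ((Real.sinh (2 * x) / Real.cosh (κ * x) ^ 2 : ℝ) : ℂ)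
        + (Real.cos θ / 2 : ℂ) * ((1 / Real.cosh (κ * x) ^ 2 : ℝ) : ℂ) := by
    intro x
    rw [kern, kern, div_mul_div_comm, ← pow_two, sinh_sq_half_period h (.inr rfl)]
    set u : ℂ := x + (-(ζ / 2) : ℝ) * Complex.I with hu
    have e1 : Complex.sinh (u + θ * Complex.I) * Complex.sinh (u + (0 : ℝ) * Complex.I)
        = (Complex.cosh ((2 * x : ℝ) + ((θ - ζ : ℝ) : ℂ) * Complex.I)
          - Complex.cosh ((θ : ℂ) * Complex.I)) / 2 := by
      have e2 : ((2 * x : ℝ) : ℂ) + ((θ - ζ : ℝ) : ℂ) * Complex.I = (u + θ * Complex.I) + u := by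
        rw [hu]
        push_cast
        ring
      have e3 : Complex.cosh ((θ : ℂ) * Complex.I) = Complex.cosh ((u + θ * Complex.I) - u) := by
        rw [add_sub_cancel_left]
      rw [e2, e3, Complex.cosh_add, Complex.cosh_sub]
      simp
    rw [e1, Complex.cosh_add, Complex.sinh_mul_I, Complex.cosh_mul_I, Complex.cosh_mul_I]
    push_cast
    ring
  simp_rw [e]
  rw [integral_add ((hint2.ofReal.const_mul _).add (hint1.ofReal.const_mul _))
    (hint3.ofReal.const_mul _), integral_add (hint2.ofReal.const_mul _) (hint1.ofReal.const_mul _),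
    integral_const_mul, integral_const_mul, integral_const_mul, integral_complex_ofReal,
    integral_complex_ofReal, integral_complex_ofReal, integral_sinh_div_cosh_sq,
    integral_cosh_div_cosh_sq hκ hζ h hs, integral_one_div_cosh_mul_sq (by linarith)]
  push_cast
  ring

/-! ### Exact relations between the double integrals without regulator -/

lemma two_le_of_mul_eq_pi {κ ζ : ℝ} (hζ : 0 < ζ) (hζ' : ζ < Real.pi / 2) (h : κ * ζ = Real.pi) :
    2 ≤ κ := by
  by_contra! hlt
  have := mul_lt_mul_of_pos_right hlt hζ
  linarith

/-- At z₀ = 0 and c = 0 the coupling becomes sinh z₁ and removes the numerator of `kern κ 0`, so the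
residue of the first string term is an explicit integral. -/
lemma kern_zero_div (κ : ℝ) {z : ℂ} (hz : Complex.sinh z ≠ 0) :
    kern κ 0 z / Complex.sinh z = 1 / Complex.sinh (κ * z) := by
  rw [kern]
  simp only [Complex.ofReal_zero, zero_mul, add_zero]
  field_simp

section

variable {κ ζ : ℝ} (hζ : 0 < ζ) (hζ' : ζ < Real.pi / 2) (h : κ * ζ = Real.pi)

/-- Translating both contours by a period identifies the integrals of the two string terms. -/
lemma pairIntegral_translate (h : κ * ζ = Real.pi) (θ y₀ y₁ : ℝ) :
    pairIntegral κ (θ - ζ) ζ (2 * ζ) y₀ y₁ = pairIntegral κ θ 0 0 (y₀ - ζ) (y₁ + ζ) := by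
  unfold pairIntegral
  congr 1
  ext x₀
  congr 1
  ext x₁
  have hc : (κ : ℂ) * ζ = Real.pi := by exact_mod_cast h
  have e0 : (κ : ℂ) * (x₀ + y₀ * Complex.I)
      = κ * (x₀ + ((y₀ - ζ : ℝ) : ℂ) * Complex.I) + Real.pi * Complex.I := by
    rw [← hc]
    push_cast
    ring
  have e1 : (κ : ℂ) * (x₁ + ((y₁ + ζ : ℝ) : ℂ) * Complex.I)
      = κ * (x₁ + y₁ * Complex.I) + Real.pi * Complex.I := by
    rw [← hc]
    push_cast
    ring
  have hsh : ∀ z : ℂ, Complex.sinh (z + Real.pi * Complex.I) = -Complex.sinh z := by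
    intro z
    rw [Complex.sinh_add, Complex.sinh_mul_I, Complex.cosh_mul_I, Complex.cos_pi, Complex.sin_pi]
    ring
  unfold pair kern
  rw [e0, e1, hsh, hsh]
  rw [show (x₀ : ℂ) + y₀ * Complex.I + ((θ - ζ : ℝ) : ℂ) * Complex.I
      = x₀ + ((y₀ - ζ : ℝ) : ℂ) * Complex.I + θ * Complex.I by push_cast; ring,
    show (x₁ : ℂ) + ((y₁ + ζ : ℝ) : ℂ) * Complex.I + ((0 : ℝ) : ℂ) * Complex.I
      = x₁ + y₁ * Complex.I + ζ * Complex.I by push_cast; ring,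
    show (x₁ : ℂ) + ((y₁ + ζ : ℝ) : ℂ) * Complex.I - (x₀ + ((y₀ - ζ : ℝ) : ℂ) * Complex.I)
      + ((0 : ℝ) : ℂ) * Complex.I
      = x₁ + y₁ * Complex.I - (x₀ + y₀ * Complex.I) + ((2 * ζ : ℝ) : ℂ) * Complex.I by
        push_cast; ring]
  -- Each side carries one sign from sinh(z + iπ) = −sinh z: the left in z₀, the right in z₁.
  simp only [div_neg, mul_neg, neg_mul]

include hζ hζ' h

/-- Crossing the pole of the outer variable in the first string term. -/
lemma pairIntegral_cross_first (θ : ℝ) {a : ℝ} (ha : -(3 / 4 * ζ) < a) (ha0 : a < 0) :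
    pairIntegral κ θ 0 0 (ζ / 2) (-(3 / 4 * ζ)) = pairIntegral κ θ 0 0 a (-(3 / 4 * ζ))
      + 2 * ζ ^ 2 * Complex.I * Real.sin θ := by
  have hκ := two_le_of_mul_eq_pi hζ hζ' h
  have hκ0 : 0 < κ := by linarith
  have hsin : ∀ t : ℝ, t ≠ 0 → -ζ < t → t < ζ → Real.sin (κ * t) ≠ 0 :=
    fun t => sin_mul_ne_zero hκ0 h
  have h34 : -(3 / 4 * ζ) ≠ 0 := by linarith
  rw [pairIntegral_cross_left (a := a) hκ θ 0 ha0 (by linarith)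
    (by nlinarith) (by nlinarith) (hsin _ h34 (by linarith) (by linarith)) ?_]
  · have e : ∀ x : ℝ, kern κ 0 (x + (-(3 / 4 * ζ) : ℝ) * Complex.I) /
        Complex.sinh (x + (-(3 / 4 * ζ) : ℝ) * Complex.I + (0 : ℝ) * Complex.I)
        = 1 / Complex.sinh (κ * (x + (-(3 / 4 * ζ) : ℝ) * Complex.I)) := by
      intro x
      rw [Complex.ofReal_zero, zero_mul, add_zero]
      refine kern_zero_div κ (sinh_ne_zero_of_sin_im ?_)
      have := sin_ne_zero_of_mem (y := -(3 / 4 * ζ)) h34 (by linarith) (by linarith)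
      simpa using this
    simp_rw [e]
    rw [integral_inv_sinh_of_neg (by linarith) (by linarith) (by nlinarith), Complex.sinh_mul_I,
      ← h]
    have hκc : (κ : ℂ) ≠ 0 := by exact_mod_cast hκ0.ne'
    push_cast
    field_simp
    linear_combination (-(2 * (ζ : ℂ) ^ 2 * Complex.sin θ * Complex.I)) * Complex.I_sq
  · intro t h1 h2
    exact sin_ne_zero_of_mem (by linarith) (by linarith) (by linarith)

/-- The difference of the two string terms. -/
lemma pairIntegral_sub (θ : ℝ) :
    pairIntegral κ θ 0 0 (ζ / 2) (-(3 / 4 * ζ))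
      - pairIntegral κ (θ - ζ) ζ (2 * ζ) (ζ / 2) (-(3 / 4 * ζ))
      = 2 * ζ ^ 2 * Complex.I * ((Real.sin θ + Real.cos θ / ζ
        - Real.cos (θ - ζ) / Real.sin ζ : ℝ) : ℂ) := by
  have hκ := two_le_of_mul_eq_pi hζ hζ' h
  have hκ0 : 0 < κ := by linarith
  have hsin : ∀ t : ℝ, t ≠ 0 → -ζ < t → t < ζ → Real.sin (κ * t) ≠ 0 :=
    fun t => sin_mul_ne_zero hκ0 h
  have hs : Real.sin ζ ≠ 0 := sin_ne_zero_of_mem hζ.ne' (by linarith) (by linarith)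
  -- After the translation the outer height is ζ/2 − ζ = −ζ/2, halfway between zeros of sinh(κz),
  -- and the inner one is −3ζ/4 + ζ = ζ/4. The inner contour reaches ζ/4 from −3ζ/4 in two moves,
  -- across the diagonal and then across the origin.
  have hdiag := pairIntegral_cross_diag (y₀ := -(ζ / 2)) (a := -(3 / 4 * ζ)) (b := -(ζ / 4)) hκ θ 0
    (by linarith) (by linarith) (by linarith) (by linarith)
    fun t h1 h2 => hsin t (by linarith) (by linarith) (by linarith)
  have hcross := pairIntegral_cross_right (y₀ := -(ζ / 2)) (c := 0) (a := -(ζ / 4)) (b := ζ / 4) hκ θ 0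
    (by linarith) (by linarith) (by nlinarith) (by nlinarith)
    (hsin _ (by linarith) (by linarith) (by linarith))
    fun t h1 h2 => sin_ne_zero_of_mem (by linarith) (by linarith) (by linarith)
  -- The residue at z₁ = 0 carries the factor sinh(iθ₁) with θ₁ = 0.
  rw [Complex.ofReal_zero, zero_mul, Complex.sinh_zero, zero_mul, mul_zero, sub_zero] at hcross
  rw [integral_kern_mul_kern hκ hζ h hs] at hdiag
  rw [pairIntegral_translate h, pairIntegral_cross_first hζ hζ' h θ (a := -(ζ / 2)) (by linarith)
    (by linarith), show ζ / 2 - ζ = -(ζ / 2) by ring, show -(3 / 4 * ζ) + ζ = ζ / 4 by ring, hcross,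
    hdiag, ← h]
  have hκc : (κ : ℂ) ≠ 0 := by exact_mod_cast hκ0.ne'
  have hζc : (ζ : ℂ) ≠ 0 := by exact_mod_cast hζ.ne'
  have hsc : Complex.sin ζ ≠ 0 := by exact_mod_cast hs
  push_cast
  field_simp
  ring

/-- The first string term for contours above the real axis. -/
lemma pairIntegral_first_upper (θ : ℝ) :
    pairIntegral κ θ 0 0 (ζ / 2) (ζ / 4) = pairIntegral κ θ 0 0 (ζ / 2) (-(3 / 4 * ζ)) := by
  have hκ := two_le_of_mul_eq_pi hζ hζ' h
  have hκ0 : 0 < κ := by linarith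
  rw [pairIntegral_cross_right (a := -(3 / 4 * ζ)) hκ θ 0 (by linarith) (by linarith)
    (by nlinarith) (by nlinarith)
    (sin_mul_ne_zero hκ0 h (by linarith) (by linarith) (by linarith))
    fun t h1 h2 => sin_ne_zero_of_mem (by linarith) (by linarith) (by linarith)]
  simp

/-- The second string term for contours above the real axis. -/
lemma pairIntegral_second_upper :
    pairIntegral κ (-(2 * ζ)) ζ (2 * ζ) (ζ / 2) (ζ / 4)
      = pairIntegral κ (-(2 * ζ)) ζ (2 * ζ) (ζ / 2) (-(3 / 4 * ζ))
        + 2 * ζ ^ 2 * Complex.I * Real.sin ζ := by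
  have hκ := two_le_of_mul_eq_pi hζ hζ' h
  have hκ0 : 0 < κ := by linarith
  rw [pairIntegral_cross_right (a := -(3 / 4 * ζ)) hκ _ _ (by linarith) (by linarith)
    (by nlinarith) (by nlinarith)
    (sin_mul_ne_zero hκ0 h (by linarith) (by linarith) (by linarith))
    fun t h1 h2 => sin_ne_zero_of_mem (by linarith) (by linarith) (by linarith)]
  -- At z₁ = 0 the coupling sinh(2iζ − z₀) cancels the numerator sinh(z₀ − 2iζ) up to sign.
  have e : ∀ x : ℝ, kern κ (-(2 * ζ)) (x + (ζ / 2 : ℝ) * Complex.I) /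
      Complex.sinh (-(x + (ζ / 2 : ℝ) * Complex.I) + (2 * ζ : ℝ) * Complex.I)
      = -(1 / Complex.sinh (κ * (x + (ζ / 2 : ℝ) * Complex.I))) := by
    intro x
    have hne : Complex.sinh (x + (ζ / 2 : ℝ) * Complex.I + (-(2 * ζ) : ℝ) * Complex.I) ≠ 0 := by
      refine sinh_ne_zero_of_sin_im ?_
      have := sin_ne_zero_of_mem (y := ζ / 2 + -(2 * ζ)) (by linarith) (by linarith) (by linarith)
      simpa using this
    have e2 : -(x + (ζ / 2 : ℝ) * Complex.I) + (2 * ζ : ℝ) * Complex.I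
        = -(x + (ζ / 2 : ℝ) * Complex.I + (-(2 * ζ) : ℝ) * Complex.I) := by
      push_cast
      ring
    rw [kern, e2, Complex.sinh_neg, div_neg, div_right_comm, div_self hne]
  simp_rw [e]
  rw [integral_neg, integral_inv_sinh_of_pos (by linarith) (by linarith) (by nlinarith),
    Complex.sinh_mul_I, ← h]
  have hκc : (κ : ℂ) ≠ 0 := by exact_mod_cast hκ0.ne'
  push_cast
  field_simp
  linear_combination (-(2 * (ζ : ℂ) ^ 2 * Complex.sin ζ * Complex.I)) * Complex.I_sq

/-- The second string term for contours below the real axis. -/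
lemma pairIntegral_second_lower :
    pairIntegral κ 0 ζ (2 * ζ) (ζ / 2) (-(3 / 4 * ζ))
      = pairIntegral κ 0 ζ (2 * ζ) (-(ζ / 4)) (-(3 / 4 * ζ)) := by
  have hκ := two_le_of_mul_eq_pi hζ hζ' h
  have hκ0 : 0 < κ := by linarith
  rw [pairIntegral_cross_left (a := -(ζ / 4)) hκ _ _ (by linarith) (by linarith)
    (by nlinarith) (by nlinarith)
    (sin_mul_ne_zero hκ0 h (by linarith) (by linarith) (by linarith))
    fun t h1 h2 => sin_ne_zero_of_mem (by linarith) (by linarith) (by linarith)]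
  -- The residue at z₀ = 0 carries the factor sinh(iθ₀) with θ₀ = 0.
  simp

end

/-! ### Removing the regulator -/

/-- The regulator `c ε` tends to `c₀`, and keeps the coupling of the two contours away from its
poles while the heights of the contours differ by at most `5ζ/4`. -/
structure IsRegulator (ζ : ℝ) (c : ℝ → ℝ) (c₀ : ℝ) : Prop where
  tendsto : Tendsto c (𝓝[>] 0) (𝓝 c₀)
  eventually_ne : ∀ᶠ ε in 𝓝[>] (0 : ℝ), ∀ d, -(5 / 4 * ζ) ≤ d → d ≤ 0 → Real.sin (d + c ε) ≠ 0
  limit_ne : ∀ d, -(5 / 4 * ζ) ≤ d → d < 0 → Real.sin (d + c₀) ≠ 0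

lemma eventually_mem_Ioo {δ : ℝ} (hδ : 0 < δ) : ∀ᶠ ε in 𝓝[>] (0 : ℝ), 0 < ε ∧ ε < δ :=
  Ioo_mem_nhdsGT hδ

/-- The bound 5ζ/4 is the distance between the final heights ζ/2 and −3ζ/4. Contours of equal height
(d = 0) are allowed only while ε > 0 pushes the argument strictly below 0; in the limit they must be
separated. -/
lemma isRegulator_neg {ζ : ℝ} (hζ : 0 < ζ) (hζ' : ζ < Real.pi / 2) :
    IsRegulator ζ (fun ε => -ε) 0 where
  tendsto := by
    have : Tendsto (fun ε : ℝ => -ε) (𝓝 0) (𝓝 (-0)) := tendsto_id.neg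
    rw [neg_zero] at this
    exact this.mono_left nhdsWithin_le_nhds
  eventually_ne := by
    filter_upwards [eventually_mem_Ioo (show 0 < ζ / 4 by linarith)] with ε hε d h1 h2
    obtain ⟨h3, h4⟩ := hε
    exact sin_ne_zero_of_mem (by linarith) (by linarith) (by linarith)
  limit_ne d h1 h2 := sin_ne_zero_of_mem (by linarith) (by linarith) (by linarith)

lemma isRegulator_add {ζ : ℝ} (hζ : 0 < ζ) (hζ' : ζ < Real.pi / 2) :
    IsRegulator ζ (fun ε => 2 * ζ + ε) (2 * ζ) where
  tendsto := by
    have : Tendsto (fun ε : ℝ => 2 * ζ + ε) (𝓝 0) (𝓝 (2 * ζ + 0)) := tendsto_id.const_add _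
    rw [add_zero] at this
    exact this.mono_left nhdsWithin_le_nhds
  eventually_ne := by
    -- For ε < π/2 − ζ the argument stays between 3ζ/4 and 2ζ + ε < ζ + π/2 < π.
    filter_upwards [eventually_mem_Ioo (sub_pos.2 hζ')] with ε hε d h1 h2
    obtain ⟨h3, h4⟩ := hε
    exact sin_ne_zero_of_mem (by linarith) (by linarith) (by linarith)
  limit_ne d h1 h2 := sin_ne_zero_of_mem (by linarith) (by linarith) (by linarith)

section

variable {κ ζ : ℝ} (hζ : 0 < ζ) (hζ' : ζ < Real.pi / 2) (h : κ * ζ = Real.pi)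
  {c : ℝ → ℝ} {c₀ : ℝ} (hc : IsRegulator ζ c c₀)

include hζ hζ' h hc

lemma tendsto_pairIntegral_of_eq (θ₀ θ₁ : ℝ) {y₀ y₁ : ℝ} {f : ℝ → ℂ}
    (h₀ : Real.sin (κ * y₀) ≠ 0) (h₁ : Real.sin (κ * y₁) ≠ 0)
    (hd : -(5 / 4 * ζ) ≤ y₁ - y₀) (hd' : y₁ - y₀ < 0)
    (hf : ∀ᶠ ε in 𝓝[>] (0 : ℝ), f ε = pairIntegral κ θ₀ θ₁ (c ε) y₀ y₁) :
    Tendsto f (𝓝[>] 0) (𝓝 (pairIntegral κ θ₀ θ₁ c₀ y₀ y₁)) := by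
  have h1 := continuousAt_pairIntegral (two_le_of_mul_eq_pi hζ hζ' h) θ₀ θ₁ h₀ h₁
    (hc.limit_ne _ hd hd')
  exact (h1.tendsto.comp hc.tendsto).congr' (hf.mono fun ε hε => hε.symm)

/-- First contour above, second contour below the real axis. -/
lemma tendsto_pairIntegral_upper_lower (θ₀ θ₁ : ℝ) :
    Tendsto (fun ε => pairIntegral κ θ₀ θ₁ (c ε) ε (-ε)) (𝓝[>] 0)
      (𝓝 (pairIntegral κ θ₀ θ₁ c₀ (ζ / 2) (-(3 / 4 * ζ)))) := by
  have hκ := two_le_of_mul_eq_pi hζ hζ' h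
  have hκ0 : 0 < κ := by linarith
  refine tendsto_pairIntegral_of_eq hζ hζ' h hc θ₀ θ₁
    (sin_mul_ne_zero hκ0 h (by linarith) (by linarith) (by linarith))
    (sin_mul_ne_zero hκ0 h (by linarith) (by linarith) (by linarith)) (by linarith) (by linarith) ?_
  filter_upwards [eventually_mem_Ioo (show 0 < ζ / 4 by linarith), hc.eventually_ne] with ε hε hne
  obtain ⟨h3, h4⟩ := hε
  rw [← pairIntegral_shift_right hκ θ₀ θ₁ (a := -(3 / 4 * ζ)) (b := -ε) (by linarith)
    (sin_mul_ne_zero hκ0 h h3.ne' (by linarith) (by linarith))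
    (fun t h1 h2 => sin_mul_ne_zero hκ0 h (by linarith) (by linarith) (by linarith))
    (fun t h1 h2 => hne _ (by linarith) (by linarith)),
    pairIntegral_shift_left hκ θ₀ θ₁ (b := ζ / 2) (by linarith)
    (sin_mul_ne_zero hκ0 h (by linarith) (by linarith) (by linarith))
    (fun t h1 h2 => sin_mul_ne_zero hκ0 h (by linarith) (by linarith) (by linarith))
    (fun t h1 h2 => hne _ (by linarith) (by linarith))]

/-- Both contours above the real axis. -/
lemma tendsto_pairIntegral_upper_upper (θ₀ θ₁ : ℝ) :
    Tendsto (fun ε => pairIntegral κ θ₀ θ₁ (c ε) ε ε) (𝓝[>] 0)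
      (𝓝 (pairIntegral κ θ₀ θ₁ c₀ (ζ / 2) (ζ / 4))) := by
  have hκ := two_le_of_mul_eq_pi hζ hζ' h
  have hκ0 : 0 < κ := by linarith
  refine tendsto_pairIntegral_of_eq hζ hζ' h hc θ₀ θ₁
    (sin_mul_ne_zero hκ0 h (by linarith) (by linarith) (by linarith))
    (sin_mul_ne_zero hκ0 h (by linarith) (by linarith) (by linarith)) (by linarith) (by linarith) ?_
  filter_upwards [eventually_mem_Ioo (show 0 < ζ / 4 by linarith), hc.eventually_ne] with ε hε hne
  obtain ⟨h3, h4⟩ := hε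
  -- The outer contour rises first, so that the inner one never lies above it, as `IsRegulator`
  -- requires.
  rw [pairIntegral_shift_left hκ θ₀ θ₁ (b := ζ / 2) (by linarith)
    (sin_mul_ne_zero hκ0 h h3.ne' (by linarith) (by linarith))
    (fun t h1 h2 => sin_mul_ne_zero hκ0 h (by linarith) (by linarith) (by linarith))
    (fun t h1 h2 => hne _ (by linarith) (by linarith)),
    pairIntegral_shift_right hκ θ₀ θ₁ (b := ζ / 4) (by linarith)
    (sin_mul_ne_zero hκ0 h (by linarith) (by linarith) (by linarith))
    (fun t h1 h2 => sin_mul_ne_zero hκ0 h (by linarith) (by linarith) (by linarith))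
    (fun t h1 h2 => hne _ (by linarith) (by linarith))]

/-- Both contours below the real axis. -/
lemma tendsto_pairIntegral_lower_lower (θ₀ θ₁ : ℝ) :
    Tendsto (fun ε => pairIntegral κ θ₀ θ₁ (c ε) (-ε) (-ε)) (𝓝[>] 0)
      (𝓝 (pairIntegral κ θ₀ θ₁ c₀ (-(ζ / 4)) (-(3 / 4 * ζ)))) := by
  have hκ := two_le_of_mul_eq_pi hζ hζ' h
  have hκ0 : 0 < κ := by linarith
  refine tendsto_pairIntegral_of_eq hζ hζ' h hc θ₀ θ₁
    (sin_mul_ne_zero hκ0 h (by linarith) (by linarith) (by linarith))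
    (sin_mul_ne_zero hκ0 h (by linarith) (by linarith) (by linarith)) (by linarith) (by linarith) ?_
  filter_upwards [eventually_mem_Ioo (show 0 < ζ / 4 by linarith), hc.eventually_ne] with ε hε hne
  obtain ⟨h3, h4⟩ := hε
  -- Here the inner contour descends first, for the same reason.
  rw [← pairIntegral_shift_right hκ θ₀ θ₁ (a := -(3 / 4 * ζ)) (b := -ε) (by linarith)
    (sin_mul_ne_zero hκ0 h (by linarith) (by linarith) (by linarith))
    (fun t h1 h2 => sin_mul_ne_zero hκ0 h (by linarith) (by linarith) (by linarith))
    (fun t h1 h2 => hne _ (by linarith) (by linarith)),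
    pairIntegral_shift_left hκ θ₀ θ₁ (a := -(ζ / 4)) (b := -ε) (by linarith)
    (sin_mul_ne_zero hκ0 h (by linarith) (by linarith) (by linarith))
    (fun t h1 h2 => sin_mul_ne_zero hκ0 h (by linarith) (by linarith) (by linarith))
    (fun t h1 h2 => hne _ (by linarith) (by linarith))]

end

/-! ### Reduction of the multiple integrals to `pairIntegral` -/

/-- The integrand attached to `e', e` has sign `s`, its factor in `λ₁` is
`sinh (λ₁ - ξ + iθ)`, and its contours have heights `y₀, y₁` relative to the strings. -/
structure ReducesTo (ζ ξ ε : ℝ) (e' e : Fin 2 → Fin 2) (s : ℂ) (θ y₀ y₁ : ℝ) : Prop where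
  Q_eq : ∀ lam : Fin 2 → ℂ, Q ζ ξ ε e' e lam =
    s * (Complex.sinh (lam 0 - ξ + θ * Complex.I) * Complex.sinh (lam 1 - ξ + ζ * Complex.I)) /
      (Complex.sinh (lam 1 - lam 0 + ζ * Complex.I + regulator ε (lam 1 - lam 0)) *
        Complex.sinh (ζ * Complex.I))
  line₀ : ∀ (γ : Fin 2) (x : ℝ),
    contourPoint ζ ε e 0 γ x = x + ((y₀ - (γ : ℕ) * ζ : ℝ) : ℂ) * Complex.I
  line₁ : ∀ (γ : Fin 2) (x : ℝ),
    contourPoint ζ ε e 1 γ x = x + ((y₁ - (γ : ℕ) * ζ : ℝ) : ℂ) * Complex.I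

lemma fin_two_fun_cases (e : Fin 2 → Fin 2) :
    e = ![0, 0] ∨ e = ![0, 1] ∨ e = ![1, 0] ∨ e = ![1, 1] := by
  revert e
  decide

lemma Iio_Ioi_fin_two : Finset.Iio (0 : Fin 2) = ∅ ∧ Finset.Iio (1 : Fin 2) = {0} ∧
    Finset.Ioi (0 : Fin 2) = {1} ∧ Finset.Ioi (1 : Fin 2) = ∅ := by
  decide

section

variable (ζ ξ ε : ℝ)

lemma reducesTo_of_weight_zero :
    ReducesTo ζ ξ ε ![0, 0] ![0, 0] 1 (-ζ) ε ε := by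
  have hp : alphaPlus ![0, 0] = {0, 1} := by decide
  have hm : alphaMinus ![0, 0] = ∅ := by decide
  obtain ⟨i1, i2, i3, i4⟩ := Iio_Ioi_fin_two
  refine ⟨fun lam => ?_, fun γ x => ?_, fun γ x => ?_⟩
  · have h0 : lamPlus ![0, 0] lam 0 = lam 1 := congrArg lam (by decide)
    have h1 : lamPlus ![0, 0] lam 1 = lam 0 := congrArg lam (by decide)
    rw [Q, hp, hm]
    simp [i1, i2, i3, i4, h0, h1, inhom, eta]
    ring_nf
  · rw [contourPoint, hp]
    simp [eta]
    ring
  · rw [contourPoint, hp]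
    simp [eta]
    ring

lemma reducesTo_of_weight_two :
    ReducesTo ζ ξ ε ![1, 1] ![1, 1] 1 ζ (-ε) (-ε) := by
  have hp : alphaPlus ![1, 1] = ∅ := by decide
  have hm : alphaMinus ![1, 1] = {0, 1} := by decide
  obtain ⟨i1, i2, i3, i4⟩ := Iio_Ioi_fin_two
  refine ⟨fun lam => ?_, fun γ x => ?_, fun γ x => ?_⟩
  · have h0 : lamMinus ![1, 1] ![1, 1] lam 0 = lam 0 := congrArg lam (by decide)
    have h1 : lamMinus ![1, 1] ![1, 1] lam 1 = lam 1 := congrArg lam (by decide)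
    rw [Q, hp, hm]
    simp [i1, i2, i3, i4, h0, h1, inhom, eta]
    ring_nf
  · rw [contourPoint, hp]
    simp [eta]
    ring
  · rw [contourPoint, hp]
    simp [eta]
    ring

/-- The choice of `e'` has no effect: it produces sinh(λ₂ − w₁ + η) or sinh(λ₂ − w₂), and these
coincide on the string w₂ = w₁ − η. -/
lemma reducesTo_zero_one {e' : Fin 2 → Fin 2} (he' : weight e' = 1) :
    ReducesTo ζ ξ ε e' ![0, 1] (-1) ζ ε (-ε) := by
  have hp : alphaPlus ![0, 1] = {0} := by decide
  obtain ⟨i1, i2, i3, i4⟩ := Iio_Ioi_fin_two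
  refine ⟨fun lam => ?_, fun γ x => ?_, fun γ x => ?_⟩
  · have h0 : lamPlus ![0, 1] lam 0 = lam 0 := congrArg lam (by decide)
    rcases fin_two_fun_cases e' with rfl | rfl | rfl | rfl
    · exact absurd he' (by decide)
    · have hm : alphaMinus ![0, 1] = {1} := by decide
      have h1 : lamMinus ![0, 1] ![0, 1] lam 1 = lam 1 := congrArg lam (by decide)
      rw [Q, hp, hm]
      simp [i1, i2, i3, i4, h0, h1, inhom, eta]
      ring_nf
    · have hm : alphaMinus ![1, 0] = {0} := by decide
      have h1 : lamMinus ![1, 0] ![0, 1] lam 0 = lam 1 := congrArg lam (by decide)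
      rw [Q, hp, hm]
      simp [i1, i3, i4, h0, h1, inhom, eta]
      ring_nf
    · exact absurd he' (by decide)
  · rw [contourPoint, hp]
    simp [eta]
    ring
  · rw [contourPoint, hp]
    simp [eta]
    ring

lemma reducesTo_one_zero {e' : Fin 2 → Fin 2} (he' : weight e' = 1) :
    ReducesTo ζ ξ ε e' ![1, 0] (-1) (-ζ) ε (-ε) := by
  have hp : alphaPlus ![1, 0] = {1} := by decide
  obtain ⟨i1, i2, i3, i4⟩ := Iio_Ioi_fin_two
  refine ⟨fun lam => ?_, fun γ x => ?_, fun γ x => ?_⟩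
  · have h0 : lamPlus ![1, 0] lam 1 = lam 0 := congrArg lam (by decide)
    rcases fin_two_fun_cases e' with rfl | rfl | rfl | rfl
    · exact absurd he' (by decide)
    · have hm : alphaMinus ![0, 1] = {1} := by decide
      have h1 : lamMinus ![0, 1] ![1, 0] lam 1 = lam 1 := congrArg lam (by decide)
      rw [Q, hp, hm]
      simp [i2, i3, i4, h0, h1, inhom, eta]
      ring_nf
    · have hm : alphaMinus ![1, 0] = {0} := by decide
      have h1 : lamMinus ![1, 0] ![1, 0] lam 0 = lam 1 := congrArg lam (by decide)
      rw [Q, hp, hm]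
      simp [i1, i2, i3, i4, h0, h1, inhom, eta]
      ring_nf
    · exact absurd he' (by decide)
  · rw [contourPoint, hp]
    simp [eta]
    ring
  · rw [contourPoint, hp]
    simp [eta]
    ring

end

/-- The shift by η/2 turns cosh into i sinh, so the density has a pole at the string position
itself; the contours at distance ε avoid it. -/
lemma rho_add_half {ζ : ℝ} (hζ : ζ ≠ 0) (z : ℂ) :
    rho ζ (z + ζ * Complex.I / 2) = 1 / (2 * ζ * Complex.I * Complex.sinh ((Real.pi / ζ : ℝ) * z)) := by
  have hζc : (ζ : ℂ) ≠ 0 := by exact_mod_cast hζ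
  have e : (Real.pi : ℂ) * (z + ζ * Complex.I / 2) / ζ
      = (Real.pi / ζ : ℝ) * z + (Real.pi / 2 : ℂ) * Complex.I := by
    push_cast
    field_simp
  rw [rho, e, Complex.cosh_add, Complex.sinh_mul_I, Complex.cosh_mul_I, Complex.sin_pi_div_two,
    Complex.cos_pi_div_two]
  ring

lemma integral_pair_translate (κ θ₀ θ₁ c y₀ y₁ ξ : ℝ) :
    ∫ x₀ : ℝ, ∫ x₁ : ℝ, pair κ θ₀ θ₁ c ((x₀ - ξ : ℝ) + y₀ * Complex.I)
      ((x₁ - ξ : ℝ) + y₁ * Complex.I) = pairIntegral κ θ₀ θ₁ c y₀ y₁ := by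
  have h1 : ∀ z₀ : ℂ, ∫ x₁ : ℝ, pair κ θ₀ θ₁ c z₀ ((x₁ - ξ : ℝ) + y₁ * Complex.I)
      = ∫ x₁ : ℝ, pair κ θ₀ θ₁ c z₀ (x₁ + y₁ * Complex.I) := fun z₀ =>
    integral_sub_right_eq_self (fun x : ℝ => pair κ θ₀ θ₁ c z₀ (x + y₁ * Complex.I)) ξ
  simp_rw [h1]
  exact integral_sub_right_eq_self (fun x : ℝ => ∫ x₁ : ℝ,
    pair κ θ₀ θ₁ c (x + y₀ * Complex.I) (x₁ + y₁ * Complex.I)) ξ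

/-- The common prefactor of the double integrals, up to sign. -/
def amplitude (ζ : ℝ) : ℂ := 1 / (4 * ζ ^ 2 * (Complex.I * Real.sin ζ))

section

variable {ζ ξ ε : ℝ} {e' e : Fin 2 → Fin 2} {s : ℂ} {θ y₀ y₁ : ℝ}
  (hr : ReducesTo ζ ξ ε e' e s θ y₀ y₁)

/-- With equal labels one column of `S` is zero. -/
lemma integrand_eq_zero (γ : Fin 2 → Fin 2) (hγ : γ 0 = γ 1) (x₀ x₁ : ℝ) :
    integrand ζ ξ ε e' e γ x₀ x₁ = 0 := by
  have : (S ζ ξ γ ![contourPoint ζ ε e 0 (γ 0) x₀, contourPoint ζ ε e 1 (γ 1) x₁]).det = 0 := by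
    rw [Matrix.det_fin_two]
    simp only [S, Matrix.of_apply, hγ]
    generalize γ 1 = k
    fin_cases k <;> simp
  rw [integrand, this, mul_zero]

include hr

/-- The imaginary part of λ₂ − λ₁ is y₁ − y₀ − ζ < 0, which fixes the sign of the regulator. The
string shift −iζ cancels η in the coupling, leaving c = −ε. -/
lemma integrand_zero_one (hζ : 0 < ζ) (hy : y₁ - ζ < y₀) (x₀ x₁ : ℝ) :
    integrand ζ ξ ε e' e ![0, 1] x₀ x₁ = -s * amplitude ζ *
      pair (Real.pi / ζ) θ 0 (-ε) ((x₀ - ξ : ℝ) + y₀ * Complex.I)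
        ((x₁ - ξ : ℝ) + y₁ * Complex.I) := by
  set z₀ : ℂ := (x₀ - ξ : ℝ) + y₀ * Complex.I with hz₀
  set z₁ : ℂ := (x₁ - ξ : ℝ) + y₁ * Complex.I with hz₁
  have c0 : contourPoint ζ ε e 0 (![0, 1] 0) x₀ = z₀ + ξ := by
    rw [hr.line₀, hz₀]
    simp
    ring
  have c1 : contourPoint ζ ε e 1 (![0, 1] 1) x₁ = z₁ + ξ - ζ * Complex.I := by
    rw [hr.line₁, hz₁]
    simp
    ring
  have hreg : regulator ε (z₁ + ξ - ζ * Complex.I - (z₀ + ξ)) = -(Complex.I * ε) := by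
    have him : (z₁ + ξ - ζ * Complex.I - (z₀ + ξ)).im < 0 := by
      simp [hz₀, hz₁]
      linarith
    rw [regulator, if_neg him.not_gt, if_pos him]
  have hdet : (S ζ ξ ![0, 1] ![z₀ + ξ, z₁ + ξ - ζ * Complex.I]).det
      = rho ζ (z₀ + ζ * Complex.I / 2) * rho ζ (z₁ + ζ * Complex.I / 2) := by
    rw [Matrix.det_fin_two]
    simp [S, inhom, eta]
    ring_nf
  rw [integrand, c0, c1, hdet, hr.Q_eq]
  simp only [Matrix.cons_val_zero, Matrix.cons_val_one]
  rw [hreg, rho_add_half hζ.ne', rho_add_half hζ.ne', pair, kern, kern, amplitude,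
    Complex.sinh_mul_I ζ, ← Complex.ofReal_sin,
    show z₀ + ξ - ξ + (θ : ℂ) * Complex.I = z₀ + θ * Complex.I by ring,
    show z₁ + ξ - ζ * Complex.I - ξ + ζ * Complex.I = z₁ + (0 : ℝ) * Complex.I by push_cast; ring,
    show z₁ + ξ - ζ * Complex.I - (z₀ + ξ) + ζ * Complex.I + -(Complex.I * ε)
      = z₁ - z₀ + (-ε : ℝ) * Complex.I by push_cast; ring]
  generalize Complex.sinh (((Real.pi / ζ : ℝ) : ℂ) * z₀) = a
  generalize Complex.sinh (((Real.pi / ζ : ℝ) : ℂ) * z₁) = b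
  generalize Complex.sinh (z₀ + θ * Complex.I) = p
  generalize Complex.sinh (z₁ + (0 : ℝ) * Complex.I) = q
  generalize Complex.sinh (z₁ - z₀ + (-ε : ℝ) * Complex.I) = t
  simp only [div_eq_mul_inv, mul_inv, Complex.inv_I]
  linear_combination (-1 / 4 * s * p * q * t⁻¹ * (Real.sin ζ : ℂ)⁻¹ * (ζ : ℂ)⁻¹ ^ 2 * a⁻¹ * b⁻¹ *
    Complex.I) * Complex.I_sq

/-- Now the imaginary part of λ₂ − λ₁ is y₁ − y₀ + ζ > 0 and the string shift adds to η, so c = 2ζ +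
ε. -/
lemma integrand_one_zero (hζ : 0 < ζ) (hy : y₀ < y₁ + ζ) (x₀ x₁ : ℝ) :
    integrand ζ ξ ε e' e ![1, 0] x₀ x₁ = s * amplitude ζ *
      pair (Real.pi / ζ) (θ - ζ) ζ (2 * ζ + ε) ((x₀ - ξ : ℝ) + y₀ * Complex.I)
        ((x₁ - ξ : ℝ) + y₁ * Complex.I) := by
  set z₀ : ℂ := (x₀ - ξ : ℝ) + y₀ * Complex.I with hz₀
  set z₁ : ℂ := (x₁ - ξ : ℝ) + y₁ * Complex.I with hz₁
  have c0 : contourPoint ζ ε e 0 (![1, 0] 0) x₀ = z₀ + ξ - ζ * Complex.I := by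
    rw [hr.line₀, hz₀]
    simp
    ring
  have c1 : contourPoint ζ ε e 1 (![1, 0] 1) x₁ = z₁ + ξ := by
    rw [hr.line₁, hz₁]
    simp
    ring
  have hreg : regulator ε (z₁ + ξ - (z₀ + ξ - ζ * Complex.I)) = Complex.I * ε := by
    have him : 0 < (z₁ + ξ - (z₀ + ξ - ζ * Complex.I)).im := by
      simp [hz₀, hz₁]
      linarith
    rw [regulator, if_pos him]
  have hdet : (S ζ ξ ![1, 0] ![z₀ + ξ - ζ * Complex.I, z₁ + ξ]).det
      = -(rho ζ (z₀ + ζ * Complex.I / 2) * rho ζ (z₁ + ζ * Complex.I / 2)) := by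
    rw [Matrix.det_fin_two]
    simp [S, inhom, eta]
    ring_nf
  rw [integrand, c0, c1, hdet, hr.Q_eq]
  simp only [Matrix.cons_val_zero, Matrix.cons_val_one]
  rw [hreg, rho_add_half hζ.ne', rho_add_half hζ.ne', pair, kern, kern, amplitude,
    Complex.sinh_mul_I ζ, ← Complex.ofReal_sin,
    show z₀ + ξ - ζ * Complex.I - ξ + (θ : ℂ) * Complex.I
      = z₀ + ((θ - ζ : ℝ) : ℂ) * Complex.I by push_cast; ring,
    show z₁ + ξ - ξ + (ζ : ℂ) * Complex.I = z₁ + ζ * Complex.I by ring,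
    show z₁ + ξ - (z₀ + ξ - ζ * Complex.I) + ζ * Complex.I + Complex.I * ε
      = z₁ - z₀ + (2 * ζ + ε : ℝ) * Complex.I by push_cast; ring]
  generalize Complex.sinh (((Real.pi / ζ : ℝ) : ℂ) * z₀) = a
  generalize Complex.sinh (((Real.pi / ζ : ℝ) : ℂ) * z₁) = b
  generalize Complex.sinh (z₀ + ((θ - ζ : ℝ) : ℂ) * Complex.I) = p
  generalize Complex.sinh (z₁ + ζ * Complex.I) = q
  generalize Complex.sinh (z₁ - z₀ + (2 * ζ + ε : ℝ) * Complex.I) = t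
  simp only [div_eq_mul_inv, mul_inv, Complex.inv_I]
  linear_combination (1 / 4 * s * p * q * t⁻¹ * (Real.sin ζ : ℂ)⁻¹ * (ζ : ℂ)⁻¹ ^ 2 * a⁻¹ * b⁻¹ *
    Complex.I) * Complex.I_sq

lemma doubleIntegral_eq (hζ : 0 < ζ) (hy : y₁ - ζ < y₀) (hy' : y₀ < y₁ + ζ) :
    doubleIntegral ζ ξ ε e' e = -s * amplitude ζ *
      (pairIntegral (Real.pi / ζ) θ 0 (-ε) y₀ y₁
        - pairIntegral (Real.pi / ζ) (θ - ζ) ζ (2 * ζ + ε) y₀ y₁) := by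
  have hu : (Finset.univ : Finset (Fin 2 → Fin 2)) = {![0, 0], ![0, 1], ![1, 0], ![1, 1]} := by
    decide
  rw [doubleIntegral, hu, Finset.sum_insert (by decide), Finset.sum_insert (by decide),
    Finset.sum_insert (by decide), Finset.sum_singleton]
  simp_rw [integrand_zero_one hr hζ hy, integrand_one_zero hr hζ hy',
    integrand_eq_zero ![0, 0] rfl, integrand_eq_zero ![1, 1] rfl, integral_const_mul,
    integral_pair_translate]
  simp only [integral_zero]
  ring

lemma integrable_integrand (hζ : 0 < ζ) (hζ' : ζ < Real.pi / 2) (hy : y₁ - ζ < y₀)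
    (hy' : y₀ < y₁ + ζ) (h₀ : Real.sin (Real.pi / ζ * y₀) ≠ 0)
    (h₁ : Real.sin (Real.pi / ζ * y₁) ≠ 0) (h : Real.sin (y₁ - y₀ + -ε) ≠ 0)
    (h' : Real.sin (y₁ - y₀ + (2 * ζ + ε)) ≠ 0) (γ : Fin 2 → Fin 2) :
    Integrable fun p : ℝ × ℝ => integrand ζ ξ ε e' e γ p.1 p.2 := by
  have hκ : 2 ≤ Real.pi / ζ := two_le_of_mul_eq_pi hζ hζ' (div_mul_cancel₀ _ hζ.ne')
  have hmp : MeasurePreserving (fun p : ℝ × ℝ => (p.1 - ξ, p.2 - ξ)) :=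
    (measurePreserving_sub_right volume ξ).prod (measurePreserving_sub_right volume ξ)
  have key : ∀ {θ₀ θ₁ c : ℝ}, Real.sin (y₁ - y₀ + c) ≠ 0 → Integrable fun p : ℝ × ℝ =>
      pair (Real.pi / ζ) θ₀ θ₁ c ((p.1 - ξ : ℝ) + y₀ * Complex.I)
        ((p.2 - ξ : ℝ) + y₁ * Complex.I) := fun {θ₀ θ₁ c} hc =>
    hmp.integrable_comp_of_integrable (integrable_pair hκ θ₀ θ₁ h₀ h₁ hc)
  rcases fin_two_fun_cases γ with rfl | rfl | rfl | rfl
  · simp [integrand_eq_zero ![0, 0] rfl]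
  · simp_rw [integrand_zero_one hr hζ hy]
    exact (key h).const_mul _
  · simp_rw [integrand_one_zero hr hζ hy']
    exact (key h').const_mul _
  · simp [integrand_eq_zero ![1, 1] rfl]

end

/-! ### The limits -/

section

variable {ζ : ℝ} (hζ : 0 < ζ) (hζ' : ζ < Real.pi / 2) (ξ : ℝ)

include hζ hζ'

lemma eventually_integrable_integrand {e' e : Fin 2 → Fin 2} {s : ℂ} {θ : ℝ} {y₀ y₁ : ℝ → ℝ}
    (h₀ : ∀ ε, |y₀ ε| = |ε|) (h₁ : ∀ ε, |y₁ ε| = |ε|) (h : ∀ ε, 0 < ε → y₁ ε ≤ y₀ ε)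
    (hr : ∀ ε, ReducesTo ζ ξ ε e' e s θ (y₀ ε) (y₁ ε)) :
    ∀ᶠ ε : ℝ in 𝓝[>] 0, ∀ γ : Fin 2 → Fin 2,
      Integrable fun p : ℝ × ℝ => integrand ζ ξ ε e' e γ p.1 p.2 := by
  have hpi := Real.pi_pos
  have hκ : Real.pi / ζ * ζ = Real.pi := div_mul_cancel₀ _ hζ.ne'
  filter_upwards [eventually_mem_Ioo (show 0 < ζ / 4 by linarith),
    (isRegulator_neg hζ hζ').eventually_ne, (isRegulator_add hζ hζ').eventually_ne] with ε hε hn hp γ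
  obtain ⟨h3, h4⟩ := hε
  have a0 := h₀ ε
  have a1 := h₁ ε
  rw [abs_of_pos h3] at a0 a1
  have b0 := abs_le.1 a0.le
  have b1 := abs_le.1 a1.le
  have hle := h ε h3
  have hsin : ∀ y : ℝ, |y| = ε → Real.sin (Real.pi / ζ * y) ≠ 0 := by
    intro y hy
    have hy' := abs_le.1 hy.le
    exact sin_mul_ne_zero (by positivity) hκ (abs_pos.1 (hy ▸ h3)) (by linarith) (by linarith)
  exact integrable_integrand (hr ε) hζ hζ' (by linarith) (by linarith) (hsin _ a0) (hsin _ a1)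
    (hn _ (by linarith) (by linarith)) (hp _ (by linarith) (by linarith)) γ

lemma sin_pos_of_lt_pi_div_two : 0 < Real.sin ζ :=
  Real.sin_pos_of_pos_of_lt_pi hζ (by linarith)

/-- At weight one, θ = ζ and θ = −ζ belong to the two sequences `e`; this identity is why each
single double integral yields half of ⟨E¹¹⟩. -/
lemma string_difference_eq {θ : ℝ} (hθ : θ = ζ ∨ θ = -ζ) :
    Real.sin θ + Real.cos θ / ζ - Real.cos (θ - ζ) / Real.sin ζ
      = Real.cos ζ / ζ - Real.cos ζ ^ 2 / Real.sin ζ := by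
  have hs := (sin_pos_of_lt_pi_div_two hζ hζ').ne'
  have h1 := Real.sin_sq_add_cos_sq ζ
  rcases hθ with rfl | rfl
  · rw [sub_self, Real.cos_zero]
    field_simp
    linear_combination θ * h1
  · rw [Real.sin_neg, Real.cos_neg, show -ζ - ζ = -(2 * ζ) by ring, Real.cos_neg, Real.cos_two_mul]
    field_simp
    linear_combination (-ζ) * h1

lemma tendsto_doubleIntegral {e' e : Fin 2 → Fin 2} {θ : ℝ} (hθ : θ = ζ ∨ θ = -ζ)
    (hr : ∀ ε, ReducesTo ζ ξ ε e' e (-1) θ ε (-ε)) :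
    Tendsto (fun ε : ℝ => doubleIntegral ζ ξ ε e' e) (𝓝[>] 0)
      (𝓝 ((Real.cos ζ * (Real.sin ζ - ζ * Real.cos ζ) / (2 * ζ * Real.sin ζ ^ 2) : ℝ) : ℂ)) := by
  have hκ : Real.pi / ζ * ζ = Real.pi := div_mul_cancel₀ _ hζ.ne'
  have h1 := ((tendsto_pairIntegral_upper_lower hζ hζ' hκ (isRegulator_neg hζ hζ') θ 0).sub
    (tendsto_pairIntegral_upper_lower hζ hζ' hκ (isRegulator_add hζ hζ') (θ - ζ) ζ)).const_mul
    (-(-1) * amplitude ζ)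
  rw [pairIntegral_sub hζ hζ' hκ, string_difference_eq hζ hζ' hθ] at h1
  convert h1.congr' _ using 2
  · have hs : (Real.sin ζ : ℂ) ≠ 0 := by exact_mod_cast (sin_pos_of_lt_pi_div_two hζ hζ').ne'
    have hζc : (ζ : ℂ) ≠ 0 := by exact_mod_cast hζ.ne'
    have hI := Complex.I_ne_zero
    rw [amplitude]
    push_cast at hs ⊢
    field_simp
    ring
  · filter_upwards [eventually_mem_Ioo (show 0 < ζ / 4 by linarith)] with ε hε
    exact (doubleIntegral_eq (hr ε) hζ (by linarith [hε.1]) (by linarith [hε.2])).symm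

lemma amplitude_mul_sub :
    -1 * amplitude ζ * (2 * ζ ^ 2 * Complex.I *
      ((Real.cos ζ / ζ - Real.cos ζ ^ 2 / Real.sin ζ : ℝ) : ℂ)
        - 2 * ζ ^ 2 * Complex.I * Real.sin ζ)
      = (((ζ - Real.sin ζ * Real.cos ζ) / (2 * ζ * Real.sin ζ ^ 2) : ℝ) : ℂ) := by
  have hs : (Real.sin ζ : ℂ) ≠ 0 := by exact_mod_cast (sin_pos_of_lt_pi_div_two hζ hζ').ne'
  have hζc : (ζ : ℂ) ≠ 0 := by exact_mod_cast hζ.ne'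
  have hI := Complex.I_ne_zero
  rw [amplitude]
  push_cast at hs ⊢
  field_simp
  linear_combination (4 * ζ : ℂ) * Complex.sin_sq_add_cos_sq ζ

/-- Both contours lie above the axis. Raising the inner one from −3ζ/4 to ζ/4 leaves the first
string term unchanged and adds 2iζ² sin ζ to the second. -/
lemma tendsto_doubleIntegral_weight_zero :
    Tendsto (fun ε : ℝ => doubleIntegral ζ ξ ε ![0, 0] ![0, 0]) (𝓝[>] 0)
      (𝓝 (((ζ - Real.sin ζ * Real.cos ζ) / (2 * ζ * Real.sin ζ ^ 2) : ℝ) : ℂ)) := by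
  have hκ : Real.pi / ζ * ζ = Real.pi := div_mul_cancel₀ _ hζ.ne'
  have h1 := ((tendsto_pairIntegral_upper_upper hζ hζ' hκ (isRegulator_neg hζ hζ') (-ζ) 0).sub
    (tendsto_pairIntegral_upper_upper hζ hζ' hκ (isRegulator_add hζ hζ') (-ζ - ζ) ζ)).const_mul
    (-1 * amplitude ζ)
  have h2 := pairIntegral_sub hζ hζ' hκ (-ζ)
  rw [string_difference_eq hζ hζ' (.inr rfl)] at h2
  rw [pairIntegral_first_upper hζ hζ' hκ, show -ζ - ζ = -(2 * ζ) by ring,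
    pairIntegral_second_upper hζ hζ' hκ, ← sub_sub] at h1
  rw [show -ζ - ζ = -(2 * ζ) by ring] at h2
  rw [h2, amplitude_mul_sub hζ hζ'] at h1
  refine h1.congr' ?_
  filter_upwards [self_mem_nhdsWithin] with ε hε
  rw [doubleIntegral_eq (reducesTo_of_weight_zero ζ ξ ε) hζ (by linarith) (by linarith),
    show -ζ - ζ = -(2 * ζ) by ring]

/-- Both contours lie below the axis. Lowering the outer one from ζ/2 to −ζ/4 takes 2iζ² sin ζ away
from the first string term; the second is unchanged because θ − ζ = 0 there. -/
lemma tendsto_doubleIntegral_weight_two :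
    Tendsto (fun ε : ℝ => doubleIntegral ζ ξ ε ![1, 1] ![1, 1]) (𝓝[>] 0)
      (𝓝 (((ζ - Real.sin ζ * Real.cos ζ) / (2 * ζ * Real.sin ζ ^ 2) : ℝ) : ℂ)) := by
  have hκ : Real.pi / ζ * ζ = Real.pi := div_mul_cancel₀ _ hζ.ne'
  have h1 := ((tendsto_pairIntegral_lower_lower hζ hζ' hκ (isRegulator_neg hζ hζ') ζ 0).sub
    (tendsto_pairIntegral_lower_lower hζ hζ' hκ (isRegulator_add hζ hζ') (ζ - ζ) ζ)).const_mul
    (-1 * amplitude ζ)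
  have h2 := pairIntegral_sub hζ hζ' hκ ζ
  rw [string_difference_eq hζ hζ' (.inl rfl), pairIntegral_cross_first hζ hζ' hκ ζ
    (a := -(ζ / 4)) (by linarith) (by linarith), sub_self, pairIntegral_second_lower hζ hζ' hκ] at h2
  rw [sub_self, eq_sub_of_add_eq ((add_sub_right_comm _ _ _).symm.trans h2),
    amplitude_mul_sub hζ hζ'] at h1
  refine h1.congr' ?_
  filter_upwards [self_mem_nhdsWithin] with ε hε
  rw [doubleIntegral_eq (reducesTo_of_weight_two ζ ξ ε) hζ (by linarith) (by linarith), sub_self]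

end

end SpinOneXXZ

end

/-! ### The one-point functions and the sum rule -/

theorem mainTheorem2 (ζ ξ : ℝ) (hζ : 0 < ζ) (hζ' : ζ < Real.pi / 2) :
    -- all the double integrals converge absolutely for small `ε > 0`
    (∀ e' e : Fin 2 → Fin 2, SpinOneXXZ.weight e' = SpinOneXXZ.weight e →
      ∀ᶠ ε : ℝ in 𝓝[>] 0, ∀ γ : Fin 2 → Fin 2,
        Integrable (fun p : ℝ × ℝ => SpinOneXXZ.integrand ζ ξ ε e' e γ p.1 p.2)) ∧
    -- `⟨E^{11}⟩ = 2 ⟨e₁^{ε'₁, ε₁} e₂^{ε'₂, ε₂}⟩`, in particular for `e₁^{11} e₂^{00}` and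
    -- for `e₁^{01} e₂^{10}`
    (∀ e' e : Fin 2 → Fin 2, SpinOneXXZ.weight e' = 1 → SpinOneXXZ.weight e = 1 →
      ∃ v : ℂ, SpinOneXXZ.IsTwoSiteValue ζ ξ e' e v ∧
        2 * v = ((Real.cos ζ * (Real.sin ζ - ζ * Real.cos ζ) / (ζ * Real.sin ζ ^ 2) : ℝ) : ℂ)) ∧
    -- the one-point functions and the sum rule
    (∃ E22 E11 E00 : ℂ,
      SpinOneXXZ.IsOnePointValue ζ ξ 2 E22 ∧
      SpinOneXXZ.IsOnePointValue ζ ξ 1 E11 ∧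
      SpinOneXXZ.IsOnePointValue ζ ξ 0 E00 ∧
      E11 = ((Real.cos ζ * (Real.sin ζ - ζ * Real.cos ζ) / (ζ * Real.sin ζ ^ 2) : ℝ) : ℂ) ∧
      E22 = (((ζ - Real.sin ζ * Real.cos ζ) / (2 * ζ * Real.sin ζ ^ 2) : ℝ) : ℂ) ∧
      E00 = (((ζ - Real.sin ζ * Real.cos ζ) / (2 * ζ * Real.sin ζ ^ 2) : ℝ) : ℂ) ∧
      E22 + E11 + E00 = 1) := by
  have hs := (SpinOneXXZ.sin_pos_of_lt_pi_div_two hζ hζ').ne'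
  have hone : ∀ e' e : Fin 2 → Fin 2, SpinOneXXZ.weight e' = 1 → SpinOneXXZ.weight e = 1 →
      ∃ θ : ℝ, (θ = ζ ∨ θ = -ζ) ∧
        ∀ ε, SpinOneXXZ.ReducesTo ζ ξ ε e' e (-1) θ ε (-ε) := by
    intro e' e he' he
    rcases SpinOneXXZ.fin_two_fun_cases e with rfl | rfl | rfl | rfl
    · exact absurd he (by decide)
    · exact ⟨ζ, .inl rfl, fun ε => SpinOneXXZ.reducesTo_zero_one ζ ξ ε he'⟩
    · exact ⟨-ζ, .inr rfl, fun ε => SpinOneXXZ.reducesTo_one_zero ζ ξ ε he'⟩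
    · exact absurd he (by decide)
  have htwo : ∀ e' e : Fin 2 → Fin 2, SpinOneXXZ.weight e' = 1 → SpinOneXXZ.weight e = 1 →
      Tendsto (fun ε : ℝ => SpinOneXXZ.doubleIntegral ζ ξ ε e' e) (𝓝[>] 0) (𝓝
        ((Real.cos ζ * (Real.sin ζ - ζ * Real.cos ζ) / (2 * ζ * Real.sin ζ ^ 2) : ℝ) : ℂ)) := by
    intro e' e he' he
    obtain ⟨θ, hθ, hr⟩ := hone e' e he' he
    exact SpinOneXXZ.tendsto_doubleIntegral hζ hζ' ξ hθ hr
  have hdouble :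
      2 * ((Real.cos ζ * (Real.sin ζ - ζ * Real.cos ζ) / (2 * ζ * Real.sin ζ ^ 2) : ℝ) : ℂ)
      = ((Real.cos ζ * (Real.sin ζ - ζ * Real.cos ζ) / (ζ * Real.sin ζ ^ 2) : ℝ) : ℂ) := by
    rw [← Complex.ofReal_ofNat, ← Complex.ofReal_mul]
    congr 1
    field_simp
  refine ⟨fun e' e hw => ?_, fun e' e he' he => ⟨_, htwo e' e he' he, hdouble⟩,
    _, _, _, ?_, ?_, ?_, rfl, rfl, rfl, ?_⟩
  · have hw' : (e' = ![0, 0] ∧ e = ![0, 0]) ∨ (e' = ![1, 1] ∧ e = ![1, 1]) ∨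
        (SpinOneXXZ.weight e' = 1 ∧ SpinOneXXZ.weight e = 1) := by
      revert e' e
      decide
    rcases hw' with ⟨rfl, rfl⟩ | ⟨rfl, rfl⟩ | ⟨he', he⟩
    · exact SpinOneXXZ.eventually_integrable_integrand hζ hζ' ξ (fun _ => rfl) (fun _ => rfl)
        (fun _ _ => le_rfl) fun ε => SpinOneXXZ.reducesTo_of_weight_zero ζ ξ ε
    · exact SpinOneXXZ.eventually_integrable_integrand hζ hζ' ξ abs_neg abs_neg
        (fun _ _ => le_rfl) fun ε => SpinOneXXZ.reducesTo_of_weight_two ζ ξ ε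
    · obtain ⟨θ, -, hr⟩ := hone e' e he' he
      exact SpinOneXXZ.eventually_integrable_integrand hζ hζ' ξ (fun _ => rfl) abs_neg
        (fun _ h => by linarith) hr
  · intro e' he'
    have h1 : e' = ![1, 1] := by
      revert e'
      decide
    have h2 : (Finset.univ.filter fun e : Fin 2 → Fin 2 =>
        SpinOneXXZ.weight e = ((2 : Fin 3) : ℕ)) = {![1, 1]} := by decide
    simp_rw [h1, h2, Finset.sum_singleton]
    exact SpinOneXXZ.tendsto_doubleIntegral_weight_two hζ hζ' ξ
  · intro e' he'
    have h2 : (Finset.univ.filter fun e : Fin 2 → Fin 2 =>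
        SpinOneXXZ.weight e = ((1 : Fin 3) : ℕ)) = {![0, 1], ![1, 0]} := by decide
    have hne : ![0, 1] ≠ (![1, 0] : Fin 2 → Fin 2) := by decide
    simp_rw [h2, Finset.sum_pair hne]
    rw [← hdouble, two_mul]
    exact (htwo e' _ he' (by decide)).add (htwo e' _ he' (by decide))
  · intro e' he'
    have h1 : e' = ![0, 0] := by
      revert e'
      decide
    have h2 : (Finset.univ.filter fun e : Fin 2 → Fin 2 =>
        SpinOneXXZ.weight e = ((0 : Fin 3) : ℕ)) = {![0, 0]} := by decide
    simp_rw [h1, h2, Finset.sum_singleton]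
    exact SpinOneXXZ.tendsto_doubleIntegral_weight_zero hζ hζ' ξ
  · rw [← Complex.ofReal_add, ← Complex.ofReal_add, ← Complex.ofReal_one]
    congr 1
    field_simp
    linear_combination (-2 * ζ) * Real.sin_sq_add_cos_sq ζ
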